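/- Let $C=\{0,1\}^{\mathbb N}$ be the Cantor space and let $\mathbf m$ be the complete product measure on $C$ (each factor carries the uniform measure). For a family $\mathbf P=(P_s)$ of subsets of $C$ indexed by the finite sequences $s$ of natural numbers (a Suslin scheme) let $$\mathbf A(\mathbf P)=\bigcup_{h\in\mathbb N^{\mathbb N}}\bigcap_{n\in\mathbb N}P_{\bar h(n)},\qquad \bar h(n)=\langle h(0),\dots,h(n-1)\rangle .$$ The Suslin functional $\mathbf S:\mathbb N^{\mathbb N}\to\{0,1\}$ is defined by $\mathbf S(g)=1$ if $\exists h\in\mathbb N^{\mathbb N}\,\forall n\; g(\bar h(n))>0$, and $\mathbf S(g)=0$ otherwise; here finite sequences are identified with their sequence numbers $\langle s\rangle\in\mathbb N$. Write $\{e\}(\mathbf S,\vec a,\vec f)=b$ for Kleene computability (schemes S1-S9) relative to $\mathbf S$, with index $e$, number arguments $\vec a$ and function arguments $\vec f$. The $\Sigma$-codes and $\Pi$-codes $f\in\mathbb N^{\mathbb N}$ and the sets $P[f]\subseteq C$ that they code are defined inductively (so that codes are labelled well-founded trees): 1. if $f(0)=0$ and $f(1)$ is the number of a finite list of finite binary sequences,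 then $f$ is a $\Sigma$-code of the clopen set of all points of $C$ that extend some sequence in the list; 2. if $f(0)=1$ and, for every finite sequence $s$, the function $f_s(n)=f(\langle\langle s\rangle,n\rangle+1)$ is a $\Pi$-code (where $\langle\cdot,\cdot\rangle$ is a computable pairing function), then $f$ is a $\Sigma$-code of $P[f]=\mathbf A((P[f_s])_s)$; 3. if $f(0)=2$ and $f'(n)=f(n+1)$ is a $\Sigma$-code, then $f$ is a $\Pi$-code of $P[f]=C\setminus P[f']$. Let $(q_n)_{n\in\mathbb N}$ be the enumeration of $\mathbb Q$ given by $q_n=(a-b)/(c+1)$, where $n$ is the code of the triple $(a,b,c)\in\mathbb N^3$. **Theorem.** The measure $\mathbf m(P[f])$, as a Dedekind cut, is computable in $\mathbf S$ uniformly in the code $f$. That is, there is a single index $e\in\mathbb N$ such that for every function $f$ that is a $\Sigma$-code or a $\Pi$-code, the set $P[f]$ is $\mathbf m$-measurable and, for all $n\in\mathbb N$, $$\{e\}(\mathbf S,n,f)=\begin{cases}1&\text{if } q_n<\mathbf m(P[f]),\\ 0&\text{if } q_n\ge \mathbf m(P[f]).\end{cases}$$ -/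

import Mathlib

namespace SuslinMeasure

/-- The finite sequences `SEQ` of natural numbers are `List ℕ`; this is the sequence number `⟨s⟩`
(a bijection `List ℕ → ℕ` with `⟨ ⟩ = 0` and `⟨x :: s⟩ = Nat.pair x ⟨s⟩ + 1`). -/
def seqNum (s : List ℕ) : ℕ := Encodable.encode s

/-- The initial segment `⟨f 0, …, f (n - 1)⟩` of `f`. -/
def initSeg (f : ℕ → ℕ) (n : ℕ) : List ℕ := (List.range n).map f

open Classical in
/-- The Suslin functional: the value is `1` if `∃ f, ∀ n, g (⟨f 0, …, f (n - 1)⟩) > 0`,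
and `0` otherwise, that is, if `∀ f, ∃ n, g (⟨f 0, …, f (n - 1)⟩) = 0`. -/
noncomputable def suslinFunctional (g : ℕ → ℕ) : ℕ :=
  if ∃ f : ℕ → ℕ, ∀ n : ℕ, 0 < g (seqNum (initSeg f n)) then 1 else 0

/-- Kleene computability relative to a functional `F` of pure type two: `KleeneComp F e a fs b`
says that `{e}(F, a, fs) = b`, where `a` is the list of number arguments and `fs` the list of
function arguments. The relation is generated by the schemes S1-S9, and the first component of an
index is the number of its scheme. -/
inductive KleeneComp (F : (ℕ → ℕ) → ℕ) : ℕ → List ℕ → List (ℕ → ℕ) → ℕ → Prop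
  /-- successor -/
  | s1 (x : ℕ) (a : List ℕ) (fs : List (ℕ → ℕ)) :
      KleeneComp F (Nat.pair 1 0) (x :: a) fs (x + 1)
  /-- constants -/
  | s2 (q : ℕ) (a : List ℕ) (fs : List (ℕ → ℕ)) :
      KleeneComp F (Nat.pair 2 q) a fs q
  /-- projection -/
  | s3 (x : ℕ) (a : List ℕ) (fs : List (ℕ → ℕ)) :
      KleeneComp F (Nat.pair 3 0) (x :: a) fs x
  /-- composition -/
  | s4 (e₁ e₂ : ℕ) (a : List ℕ) (fs : List (ℕ → ℕ)) (c b : ℕ) :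
      KleeneComp F e₂ a fs c → KleeneComp F e₁ (c :: a) fs b →
      KleeneComp F (Nat.pair 4 (Nat.pair e₁ e₂)) a fs b
  /-- primitive recursion, base -/
  | s5_zero (e₁ e₂ : ℕ) (a : List ℕ) (fs : List (ℕ → ℕ)) (b : ℕ) :
      KleeneComp F e₁ a fs b →
      KleeneComp F (Nat.pair 5 (Nat.pair e₁ e₂)) (0 :: a) fs b
  /-- primitive recursion, step -/
  | s5_succ (e₁ e₂ x : ℕ) (a : List ℕ) (fs : List (ℕ → ℕ)) (c b : ℕ) :
      KleeneComp F (Nat.pair 5 (Nat.pair e₁ e₂)) (x :: a) fs c →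
      KleeneComp F e₂ (x :: c :: a) fs b →
      KleeneComp F (Nat.pair 5 (Nat.pair e₁ e₂)) ((x + 1) :: a) fs b
  /-- permutation of number arguments: a chosen one is moved to the front -/
  | s6_num (e₁ x : ℕ) (l r : List ℕ) (fs : List (ℕ → ℕ)) (b : ℕ) :
      KleeneComp F e₁ (x :: (l ++ r)) fs b →
      KleeneComp F (Nat.pair 6 (Nat.pair 0 (Nat.pair l.length e₁))) (l ++ x :: r) fs b
  /-- permutation of function arguments: a chosen one is moved to the front -/
  | s6_fun (e₁ : ℕ) (a : List ℕ) (f : ℕ → ℕ) (l r : List (ℕ → ℕ)) (b : ℕ) :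
      KleeneComp F e₁ a (f :: (l ++ r)) b →
      KleeneComp F (Nat.pair 6 (Nat.pair 1 (Nat.pair l.length e₁))) a (l ++ f :: r) b
  /-- application of a function argument -/
  | s7 (x : ℕ) (a : List ℕ) (f : ℕ → ℕ) (fs : List (ℕ → ℕ)) :
      KleeneComp F (Nat.pair 7 0) (x :: a) (f :: fs) (f x)
  /-- application of `F` to the function `n ↦ {e₁}(F, n, a, fs)`, which has to be total -/
  | s8 (e₁ : ℕ) (a : List ℕ) (fs : List (ℕ → ℕ)) (g : ℕ → ℕ) :
      (∀ n : ℕ, KleeneComp F e₁ (n :: a) fs (g n)) →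
      KleeneComp F (Nat.pair 8 e₁) a fs (F g)
  /-- enumeration: an argument is used as an index -/
  | s9 (x : ℕ) (a a' : List ℕ) (fs fs' : List (ℕ → ℕ)) (b : ℕ) :
      KleeneComp F x a fs b →
      KleeneComp F (Nat.pair 9 (Nat.pair a.length fs.length)) (x :: (a ++ a')) (fs ++ fs') b

/-- The Cantor space. -/
abbrev Cantor : Type := ℕ → Bool

/-- The Suslin operator `A(P) = ⋃ f, ⋂ n, P_{⟨f 0, …, f (n - 1)⟩}` on Suslin schemes. -/
def suslinOp (P : List ℕ → Set Cantor) : Set Cantor :=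
  ⋃ f : ℕ → ℕ, ⋂ n : ℕ, P (initSeg f n)

/-- The clopen set given by a finite list of finite binary sequences: the points that extend one of
the sequences in the list. -/
def clopenOf (L : List (List Bool)) : Set Cantor :=
  {x | ∃ s ∈ L, ∀ (i : ℕ) (h : i < s.length), x i = s[i]}

/-- The two kinds of codes. -/
inductive CodeKind
  | sigma
  | pi

/-- The code `f_s` that is extracted from a code `f` of the value of the Suslin operator. -/
def subcode (f : ℕ → ℕ) (s : List ℕ) : ℕ → ℕ := fun n => f (Nat.pair (seqNum s) n + 1)

/-- `IsCode .sigma f P` (`IsCode .pi f P`): the function `f` is a `Σ`-code (a `Π`-code) and `P` is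
the set `P[f]` that it codes. A code is a labelled well-founded tree, presented by its root label
`f 0` and the codes of its immediate subtrees:
* label `0`: a `Σ`-code of the clopen set with number `f 1`;
* label `1`: all `f_s` are `Π`-codes, and `f` is a `Σ`-code of the value of the Suslin operator at
  the scheme `s ↦ P[f_s]`;
* label `2`: the rest `n ↦ f (n + 1)` is a `Σ`-code, and `f` is a `Π`-code of the complement. -/
inductive IsCode : CodeKind → (ℕ → ℕ) → Set Cantor → Prop
  | clopen (f : ℕ → ℕ) (L : List (List Bool)) :
      f 0 = 0 → f 1 = Encodable.encode L → IsCode .sigma f (clopenOf L)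
  | suslin (f : ℕ → ℕ) (P : List ℕ → Set Cantor) :
      f 0 = 1 → (∀ s : List ℕ, IsCode .pi (subcode f s) (P s)) → IsCode .sigma f (suslinOp P)
  | compl (f : ℕ → ℕ) (P : Set Cantor) :
      f 0 = 2 → IsCode .sigma (fun n => f (n + 1)) P → IsCode .pi f Pᶜ

/-- A code determines the set that it codes. -/
theorem IsCode.unique {k k' : CodeKind} {f : ℕ → ℕ} {P Q : Set Cantor}
    (hP : IsCode k f P) (hQ : IsCode k' f Q) : P = Q := by
  induction hP generalizing k' Q with
  | clopen f L h0 h1 =>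
    cases hQ with
    | clopen _ L' _ h1' => rw [Encodable.encode_injective (h1.symm.trans h1')]
    | suslin _ _ h _ => omega
    | compl _ _ h _ => omega
  | suslin f R h0 _ ih =>
    cases hQ with
    | clopen _ _ h _ => omega
    | suslin _ R' _ h' => rw [show R = R' from funext fun s => ih s (h' s)]
    | compl _ _ h _ => omega
  | compl f R h0 _ ih =>
    cases hQ with
    | clopen _ _ h _ => omega
    | suslin _ _ h _ => omega
    | compl _ _ _ h' => rw [ih h']

/-- The product measure on the Cantor space of the uniform measure on the two-point space. Its
completion is the restriction to the sets that satisfy `NullMeasurableSet`. -/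
noncomputable def cantorMeasure : MeasureTheory.Measure Cantor :=
  MeasureTheory.Measure.infinitePi fun _ : ℕ => (PMF.uniformOfFintype Bool).toMeasure

/-- A standard enumeration of the rational numbers: the triple `(a, b, c)`, coded as
`Nat.pair (Nat.pair a b) c`, stands for `(a - b) / (c + 1)`. -/
def ratEnum (n : ℕ) : ℚ :=
  ((n.unpair.1.unpair.1 : ℚ) - (n.unpair.1.unpair.2 : ℚ)) / ((n.unpair.2 : ℚ) + 1)

open Classical in
/-- The characteristic function of the Dedekind cut `{q ∈ ℚ | q < r}` of `r`. -/
noncomputable def dedekindCut (r : ℝ) (n : ℕ) : ℕ :=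
  if (ratEnum n : ℝ) < r then 1 else 0

end SuslinMeasure

/-! Every coded set `P` is approximated in measure by clopen sets, and the number of a clopen set
within `2 ^ (-k)` of `P` is computable in `S` from the code and `k` (`exists_run_approx`).
Measurability then follows by Borel-Cantelli, and `q < m(P)` says that for some `k` the `k`-th
approximation has measure above `q + 2 ^ (-k)`. This is a number quantifier, and `S` decides it
(`exists_run_cut`).

The approximations are computed by recursion along the code tree. Complements are immediate. At a
Suslin node the sets `P_s` are replaced by clopen approximations with summable errors, so the core
is a scheme of clopen sets, with value `A`. For a bound `h`, the points having a branch of length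
`n` bounded by `h` form a clopen stage. The stages decrease, and by compactness of `{f | f ≤ h}`
their intersection lies in `A` (`iInter_stage_subset`). Conversely, if `q < m(A)`, continuity from
below yields an `h` all of whose stages have measure above `q` (`exists_lt_measure_stage`). Hence,
up to strictness, a lower bound on `m(A)` has the form `∃ h, ∀ n` of a decidable condition on the
initial segment of `h`, which is what `S` decides. This locates `m(A)` up to `2 ^ (-k)`, and a late
stage is then a clopen set close to `A` (`exists_isNear`, `IsNear.measure_symmDiff_le`); its number
is found by search.

The recursion theorem supplies the index. The function argument remains the original code
throughout, and subtrees are named by finite addresses. -/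

namespace SuslinMeasure

/-! ### S1-S9 indices of primitive recursive functions -/

section Indices

variable {F : (ℕ → ℕ) → ℕ}

/-- The index that moves the argument at position `p` to the front and continues with `e`. -/
def moveIx (p e : ℕ) : ℕ := Nat.pair 6 (Nat.pair 0 (Nat.pair p e))

theorem KleeneComp.move {e x b : ℕ} {l r : List ℕ} {fs : List (ℕ → ℕ)} {p : ℕ} (hp : l.length = p)
    (h : KleeneComp F e (x :: (l ++ r)) fs b) : KleeneComp F (moveIx p e) (l ++ x :: r) fs b := by
  subst hp
  exact KleeneComp.s6_num e x l r fs b h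

/-- S6 moves one argument at a time. Moving the last entry of the block `w ++ v` to the front,
`v.length` times, carries `v` past `w`. Composition needs this to reach the original arguments
behind values already computed. -/
theorem KleeneComp.rotate {fs : List (ℕ → ℕ)} {rest : List ℕ} {p e b : ℕ} (v : List ℕ) :
    ∀ w : List ℕ, w.length + v.length = p + 1 → KleeneComp F e (v ++ (w ++ rest)) fs b →
      KleeneComp F ((moveIx p)^[v.length] e) (w ++ (v ++ rest)) fs b := by
  induction v using List.reverseRecOn with
  | nil => intro w _ h; simpa using h
  | append_singleton v x ih =>
    intro w hw h
    rw [List.length_append, List.length_singleton, Function.iterate_succ_apply']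
    have h' := ih (x :: w) (by simp at hw ⊢; omega) (by simpa using h)
    have := KleeneComp.move (F := F) (l := w ++ v) (r := rest) (x := x) (p := p)
      (by simp at hw ⊢; omega) (by simpa using h')
    simpa using this

/-- The index of a primitive recursive function of several arguments. -/
theorem exists_index_of_primrec' {n : ℕ} {g : List.Vector ℕ n → ℕ} (hg : Nat.Primrec' g) :
    ∃ e, ∀ (fs : List (ℕ → ℕ)) (v : List.Vector ℕ n) (rest : List ℕ),
      KleeneComp F e (v.toList ++ rest) fs (g v) := by
  induction hg with
  | zero => exact ⟨_, fun fs v rest => KleeneComp.s2 0 _ fs⟩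
  | succ =>
    refine ⟨Nat.pair 1 0, fun fs v rest => ?_⟩
    obtain ⟨x, v, rfl⟩ := v.exists_eq_cons
    simpa using KleeneComp.s1 x (v.toList ++ rest) fs
  | @get n i =>
    refine ⟨moveIx i (Nat.pair 3 0), fun fs v rest => ?_⟩
    have hi : (i : ℕ) < v.toList.length := by simp
    have h1 : v.toList = v.toList.take i ++ v.get i :: v.toList.drop (i + 1) := by
      rw [List.Vector.get_eq_get_toList]
      simp
    rw [h1, List.append_assoc, List.cons_append]
    exact KleeneComp.move (by simp) (KleeneComp.s3 _ _ _)
  | @comp m n f g _ _ ihf ihg =>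
    obtain ⟨ef, hf⟩ := ihf
    choose eg hg using ihg
    -- The values `g i v` are stacked in front of the arguments, the last one first; `drop k` is the
    -- stack while the values with index below `k` are still missing.
    suffices H : ∀ (k : ℕ) (hk : k ≤ n) (e : ℕ), ∃ e', ∀ (fs : List (ℕ → ℕ)) (b : ℕ)
        (v : List.Vector ℕ m) (rest : List ℕ),
        KleeneComp F e ((List.ofFn fun i => g i v) ++ (v.toList ++ rest)) fs b →
        KleeneComp F e' (((List.ofFn fun i => g i v).drop k) ++ (v.toList ++ rest)) fs b by
      obtain ⟨e', he'⟩ := H n le_rfl ef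
      refine ⟨e', fun fs v rest => ?_⟩
      have := he' fs (f (List.Vector.ofFn fun i => g i v)) v rest
        (by simpa using hf fs (List.Vector.ofFn fun i => g i v) (v.toList ++ rest))
      rwa [List.drop_of_length_le (by simp), List.nil_append] at this
    intro k
    induction k with
    | zero => exact fun _ e => ⟨e, fun fs b v rest h => by simpa using h⟩
    | succ k ih =>
      intro hk e
      obtain ⟨e', he'⟩ := ih (by omega) e
      refine ⟨Nat.pair 4 (Nat.pair e' ((moveIx (n - (k + 1) + m - 1))^[m] (eg ⟨k, hk⟩))),
        fun fs b v rest h => KleeneComp.s4 _ _ _ _ (g ⟨k, hk⟩ v) _ ?_ ?_⟩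
      · have hv : v.toList.length = m := by simp
        -- With no arguments nothing has to be rotated, and the truncated subtraction in the
        -- position could violate the length condition of `rotate`.
        rcases Nat.eq_zero_or_pos m with hm | hm
        · subst hm
          have h2 : v.toList = [] := List.eq_nil_of_length_eq_zero hv
          have := hg ⟨k, hk⟩ fs v ((List.ofFn fun i => g i v).drop (k + 1) ++ rest)
          rw [h2] at this ⊢
          simpa using this
        · have := KleeneComp.rotate (F := F) (fs := fs) (rest := rest)
            (p := n - (k + 1) + m - 1) v.toList
            ((List.ofFn fun i => g i v).drop (k + 1)) (by simp; omega)
            (hg ⟨k, hk⟩ fs v _)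
          rwa [hv] at this
      · have := he' fs b v rest h
        rw [List.drop_eq_getElem_cons (i := k) (by simpa using hk)] at this
        simpa using this
  | @prec n f g _ _ ihf ihg =>
    obtain ⟨ef, hf⟩ := ihf
    obtain ⟨eg, hg⟩ := ihg
    refine ⟨Nat.pair 5 (Nat.pair ef eg), fun fs v rest => ?_⟩
    obtain ⟨x, v, rfl⟩ := v.exists_eq_cons
    simp only [List.Vector.head_cons, List.Vector.tail_cons, List.Vector.toList_cons,
      List.cons_append]
    induction x with
    | zero => exact KleeneComp.s5_zero _ _ _ _ _ (hf fs v rest)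
    | succ x ih =>
      exact KleeneComp.s5_succ _ _ _ _ _ _ _ ih (by simpa using hg fs (x ::ᵥ _ ::ᵥ v) rest)

theorem exists_index_of_primrec {g : ℕ → ℕ} (hg : Primrec g) :
    ∃ e, ∀ (fs : List (ℕ → ℕ)) (x : ℕ) (rest : List ℕ), KleeneComp F e (x :: rest) fs (g x) := by
  obtain ⟨e, he⟩ := exists_index_of_primrec' (F := F) (Nat.Primrec'.prim_iff₁.2 hg)
  exact ⟨e, fun fs x rest => by simpa using he fs (x ::ᵥ List.Vector.nil) rest⟩

theorem exists_index_natPair :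
    ∃ e, ∀ (fs : List (ℕ → ℕ)) (x y : ℕ) (rest : List ℕ),
      KleeneComp F e (x :: y :: rest) fs (Nat.pair x y) := by
  obtain ⟨e, he⟩ := exists_index_of_primrec' (F := F) Nat.Primrec'.natPair
  exact ⟨e, fun fs x y rest => by simpa using he fs (x ::ᵥ y ::ᵥ List.Vector.nil) rest⟩

end Indices

/-! ### Composition, universal index, recursion theorem and search -/

section Run

/-- `Run F f e x y`: in the functional `F` and the function `f`, the index `e` yields the value `y`
at the argument `x`, whatever further arguments are supplied. -/
def Run (F : (ℕ → ℕ) → ℕ) (f : ℕ → ℕ) (e x y : ℕ) : Prop :=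
  ∀ rest : List ℕ, KleeneComp F e (x :: rest) [f] y

/-- An index of the pairing function of two arguments. -/
noncomputable def natPairIx (F : (ℕ → ℕ) → ℕ) : ℕ := (exists_index_natPair (F := F)).choose

theorem natPairIx_spec {F : (ℕ → ℕ) → ℕ} (fs : List (ℕ → ℕ)) (x y : ℕ) (rest : List ℕ) :
    KleeneComp F (natPairIx F) (x :: y :: rest) fs (Nat.pair x y) :=
  (exists_index_natPair (F := F)).choose_spec fs x y rest

/-- The index of a composition. -/
def compIx (e₁ e₂ : ℕ) : ℕ := Nat.pair 4 (Nat.pair e₁ e₂)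

/-- The index of the pair of the values of two indices. -/
noncomputable def pairIx (F : (ℕ → ℕ) → ℕ) (e₁ e₂ : ℕ) : ℕ :=
  compIx (compIx (natPairIx F) (moveIx 1 e₁)) e₂

variable {F : (ℕ → ℕ) → ℕ} {f : ℕ → ℕ}

theorem Run.const (q x : ℕ) : Run F f (Nat.pair 2 q) x q := fun _ => KleeneComp.s2 _ _ _

theorem Run.id (x : ℕ) : Run F f (Nat.pair 3 0) x x := fun _ => KleeneComp.s3 _ _ _

theorem Run.oracle (x : ℕ) : Run F f (Nat.pair 7 0) x (f x) := fun _ => KleeneComp.s7 _ _ _ _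

theorem Run.comp {e₁ e₂ x y z : ℕ} (h₁ : Run F f e₁ y z) (h₂ : Run F f e₂ x y) :
    Run F f (compIx e₁ e₂) x z :=
  fun rest => KleeneComp.s4 _ _ _ _ _ _ (h₂ rest) (h₁ _)

theorem Run.pair {e₁ e₂ x y z : ℕ} (h₁ : Run F f e₁ x y) (h₂ : Run F f e₂ x z) :
    Run F f (pairIx F e₁ e₂) x (Nat.pair y z) :=
  fun rest => KleeneComp.s4 _ _ _ _ _ _ (h₂ rest) <|
    KleeneComp.s4 _ _ _ _ _ _
      (KleeneComp.move (l := [z]) (r := rest) rfl (h₁ _)) (natPairIx_spec _ _ _ _)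

theorem exists_run_of_primrec (F : (ℕ → ℕ) → ℕ) {g : ℕ → ℕ} (hg : Primrec g) :
    ∃ e, ∀ f x, Run F f e x (g x) := by
  obtain ⟨e, he⟩ := exists_index_of_primrec (F := F) hg
  exact ⟨e, fun f x => he [f] x⟩

theorem Run.functional {e x : ℕ} {g : ℕ → ℕ} (h : ∀ n, Run F f e (Nat.pair n x) (g n)) :
    Run F f (Nat.pair 8 (compIx e (natPairIx F))) x (F g) :=
  fun _ => KleeneComp.s8 _ _ _ _ fun n =>
    KleeneComp.s4 _ _ _ _ _ _ (natPairIx_spec _ _ _ _) (h n _)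

/-- There is a universal index. -/
theorem exists_run_apply (F : (ℕ → ℕ) → ℕ) :
    ∃ e, ∀ f i x y, Run F f i x y → Run F f e (Nat.pair i x) y := by
  obtain ⟨l, hl⟩ := exists_index_of_primrec (F := F) (Primrec.fst.comp Primrec.unpair)
  obtain ⟨r, hr⟩ := exists_index_of_primrec (F := F) (Primrec.snd.comp Primrec.unpair)
  refine ⟨compIx (compIx (Nat.pair 9 (Nat.pair 1 1)) (moveIx 1 l)) r, fun f i x y h rest => ?_⟩
  refine KleeneComp.s4 _ _ _ _ x _ (by simpa using hr [f] (Nat.pair i x) rest) ?_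
  refine KleeneComp.s4 _ _ _ _ i _
    (KleeneComp.move (l := [x]) rfl (by simpa using hl [f] (Nat.pair i x) (x :: rest))) ?_
  exact KleeneComp.s9 i [x] (Nat.pair i x :: rest) [f] [] y (h [])

theorem primrec_compIx : Primrec₂ compIx :=
  Primrec₂.natPair.comp (Primrec.const 4) Primrec₂.natPair

theorem primrec_pairIx (F : (ℕ → ℕ) → ℕ) : Primrec₂ (pairIx F) :=
  primrec_compIx.comp (primrec_compIx.comp (Primrec.const _)
    (Primrec₂.natPair.comp (Primrec.const 6) (Primrec₂.natPair.comp (Primrec.const 0)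
      (Primrec₂.natPair.comp (Primrec.const 1) Primrec.fst)))) Primrec.snd

/-- The index that supplies the first component of the argument. -/
noncomputable def smnIx (F : (ℕ → ℕ) → ℕ) (e c : ℕ) : ℕ :=
  compIx e (pairIx F (Nat.pair 2 c) (Nat.pair 3 0))

theorem Run.smn {e c x y : ℕ} (h : Run F f e (Nat.pair c x) y) : Run F f (smnIx F e c) x y :=
  h.comp ((Run.const c x).pair (Run.id x))

theorem primrec_smnIx (F : (ℕ → ℕ) → ℕ) : Primrec₂ (smnIx F) :=
  primrec_compIx.comp Primrec.fst ((primrec_pairIx F).comp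
    (Primrec₂.natPair.comp (Primrec.const 2) Primrec.snd) (Primrec.const _))

/-- The recursion theorem. -/
theorem exists_run_fixedPoint (F : (ℕ → ℕ) → ℕ) (e : ℕ) :
    ∃ r, ∀ f x y, Run F f e (Nat.pair r x) y → Run F f r x y := by
  obtain ⟨d, hd⟩ := exists_run_of_primrec F
    (g := fun z => Nat.pair (smnIx F z.unpair.1 z.unpair.1) z.unpair.2)
    (Primrec₂.natPair.comp
      ((primrec_smnIx F).comp (Primrec.fst.comp Primrec.unpair) (Primrec.fst.comp Primrec.unpair))
      (Primrec.snd.comp Primrec.unpair))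
  -- Diagonalization: with `c = compIx e d`, the index `smnIx F c c` runs `c` on `⟨c, x⟩`; there `d`
  -- forms `⟨smnIx F c c, x⟩`, and `e` receives its own fixed point.
  refine ⟨smnIx F (compIx e d) (compIx e d), fun f x y h => Run.smn (Run.comp h ?_)⟩
  simpa using hd f (Nat.pair (compIx e d) x)

/-- Branching: the index to be applied is computed from a value. -/
theorem exists_run_branch (F : (ℕ → ℕ) → ℕ) {I : ℕ → ℕ} (hI : Primrec I) (c : ℕ) :
    ∃ e, ∀ f x v y, Run F f c x v → Run F f (I v) x y → Run F f e x y := by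
  obtain ⟨i, hi⟩ := exists_run_of_primrec F hI
  obtain ⟨a, ha⟩ := exists_run_apply F
  exact ⟨_, fun f x v y h₁ h₂ => (ha f _ _ _ h₂).comp (((hi f v).comp h₁).pair (Run.id x))⟩

/-- Unbounded search. -/
theorem exists_run_search (F : (ℕ → ℕ) → ℕ) (q : ℕ) :
    ∃ e, ∀ f z (p : ℕ → Bool), (∀ n, Run F f q (Nat.pair z n) (p n).toNat) → (∃ n, p n) →
      ∃ m, p m ∧ Run F f e z m := by
  obtain ⟨a, ha⟩ := exists_run_apply F
  obtain ⟨ret, hret⟩ := exists_run_of_primrec F (g := fun x => x.unpair.2.unpair.2)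
    (Primrec.snd.comp (Primrec.unpair.comp (Primrec.snd.comp Primrec.unpair)))
  obtain ⟨nxt, hnxt⟩ := exists_run_of_primrec F
    (g := fun x => Nat.pair x.unpair.1
      (Nat.pair x.unpair.2.unpair.1 (x.unpair.2.unpair.2 + 1)))
    (Primrec₂.natPair.comp (Primrec.fst.comp Primrec.unpair)
      (Primrec₂.natPair.comp
        (Primrec.fst.comp (Primrec.unpair.comp (Primrec.snd.comp Primrec.unpair)))
        (Primrec.succ.comp
          (Primrec.snd.comp (Primrec.unpair.comp (Primrec.snd.comp Primrec.unpair))))))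
  obtain ⟨tl, htl⟩ := exists_run_of_primrec F (g := fun x => x.unpair.2)
    (Primrec.snd.comp Primrec.unpair)
  obtain ⟨t, ht⟩ := exists_run_branch F
    (I := fun v => if v = 0 then compIx a nxt else ret)
    (Primrec.ite (Primrec.eq.comp Primrec.id (Primrec.const 0)) (Primrec.const _)
      (Primrec.const _)) (compIx q tl)
  obtain ⟨r, hr⟩ := exists_run_fixedPoint F t
  refine ⟨compIx r (pairIx F (Nat.pair 3 0) (Nat.pair 2 0)), fun f z p hp hex => ?_⟩
  classical
  -- Induction on the distance `j` from `n` to the least witness; the test at `n` either returns `n`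
  -- or calls `r` again at `n + 1`.
  have key : ∀ j n, n + j = Nat.find hex → Run F f r (Nat.pair z n) (Nat.find hex) := by
    intro j
    induction j with
    | zero =>
      intro n hn
      have hpn : p n = true := by
        have := Nat.find_spec hex
        rwa [← hn] at this
      refine hr _ _ _ (ht _ _ 1 _ ((by simpa [hpn] using hp n : Run F f q (Nat.pair z n) 1).comp
        (by simpa using htl f (Nat.pair r (Nat.pair z n)))) ?_)
      simpa [← hn] using hret f (Nat.pair r (Nat.pair z n))
    | succ j ih =>
      intro n hn
      have hpn : p n = false := by simpa using Nat.find_min hex (m := n) (by omega)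
      refine hr _ _ _ (ht _ _ 0 _ ((by simpa [hpn] using hp n : Run F f q (Nat.pair z n) 0).comp
        (by simpa using htl f (Nat.pair r (Nat.pair z n)))) ?_)
      have h2 := ha f r (Nat.pair z (n + 1)) _ (ih (n + 1) (by omega))
      simpa using h2.comp (by simpa using hnxt f (Nat.pair r (Nat.pair z n)))
  exact ⟨Nat.find hex, Nat.find_spec hex,
    (key _ 0 (Nat.zero_add _)).comp ((Run.id z).pair (Run.const 0 z))⟩

end Run

/-! ### Uniform computability and decidability in the Suslin functional -/

open Encodable

/-- A family of environments for computations: each environment supplies a function argument and a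
number. -/
structure Context where
  /-- the type of environments -/
  carrier : Type
  /-- the function argument -/
  fn : carrier → ℕ → ℕ
  /-- the number argument -/
  base : carrier → ℕ

section Calculus

variable {Γ : Context} {α β γ δ : Type} [Primcodable α] [Primcodable β] [Primcodable γ]
  [Primcodable δ]

/-- `φ` is computable in the Suslin functional, uniformly in the environment. -/
def Cx (Γ : Context) (φ : Γ.carrier → α → β) : Prop :=
  ∃ e, ∀ i a, Run suslinFunctional (Γ.fn i) e (Nat.pair (Γ.base i) (encode a)) (encode (φ i a))

open Classical in
/-- `p` is decidable in the Suslin functional, uniformly in the environment. -/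
def CxP (Γ : Context) (p : Γ.carrier → α → Prop) : Prop := Cx Γ fun i a => decide (p i a)

theorem Cx.of_primrec {g : α → β} (hg : Primrec g) : Cx Γ fun _ a => g a := by
  obtain ⟨e, he⟩ := exists_run_of_primrec suslinFunctional
    -- Encoding `some b` adds one to the code of `b`; the predecessor removes it.
    (g := fun x => (encode ((decode (α := α) x.unpair.2).map g)).pred)
    (Primrec.pred.comp (Primrec.encode.comp (Primrec.option_map
      (Primrec.decode.comp (Primrec.snd.comp Primrec.unpair)) (hg.comp Primrec.snd).to₂)))
  exact ⟨e, fun i a => by simpa using he (Γ.fn i) (Nat.pair (Γ.base i) (encode a))⟩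

theorem Cx.comp {ψ : Γ.carrier → β → γ} {φ : Γ.carrier → α → β} (hψ : Cx Γ ψ) (hφ : Cx Γ φ) :
    Cx Γ fun i a => ψ i (φ i a) := by
  obtain ⟨d, hd⟩ := hψ
  obtain ⟨e, he⟩ := hφ
  obtain ⟨l, hl⟩ := exists_run_of_primrec suslinFunctional (Primrec.fst.comp Primrec.unpair)
  refine ⟨_, fun i a => (hd i (φ i a)).comp (Run.pair (e₁ := l) ?_ (he i a))⟩
  simpa using hl (Γ.fn i) (Nat.pair (Γ.base i) (encode a))

theorem Cx.pair {φ : Γ.carrier → α → β} {ψ : Γ.carrier → α → γ} (hφ : Cx Γ φ) (hψ : Cx Γ ψ) :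
    Cx Γ fun i a => (φ i a, ψ i a) := by
  obtain ⟨d, hd⟩ := hφ
  obtain ⟨e, he⟩ := hψ
  exact ⟨_, fun i a => (hd i a).pair (he i a)⟩

theorem Cx.prim {g : β → γ} (hg : Primrec g) {φ : Γ.carrier → α → β} (hφ : Cx Γ φ) :
    Cx Γ fun i a => g (φ i a) :=
  Cx.comp (Cx.of_primrec hg) hφ

theorem Cx.prim₂ {g : β → γ → δ} (hg : Primrec₂ g) {φ : Γ.carrier → α → β}
    {ψ : Γ.carrier → α → γ} (hφ : Cx Γ φ) (hψ : Cx Γ ψ) : Cx Γ fun i a => g (φ i a) (ψ i a) :=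
  Cx.prim (g := fun p : β × γ => g p.1 p.2) hg (hφ.pair hψ)

theorem Cx.base : Cx Γ fun i (_ : α) => Γ.base i := by
  obtain ⟨l, hl⟩ := exists_run_of_primrec suslinFunctional (Primrec.fst.comp Primrec.unpair)
  exact ⟨l, fun i a => by simpa using hl (Γ.fn i) (Nat.pair (Γ.base i) (encode a))⟩

theorem Cx.oracle {φ : Γ.carrier → α → ℕ} (hφ : Cx Γ φ) : Cx Γ fun i a => Γ.fn i (φ i a) := by
  obtain ⟨e, he⟩ := hφ
  exact ⟨_, fun i a => (Run.oracle (φ i a)).comp (he i a)⟩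

/-- A value that is computed by an index that is itself computed is computable. -/
theorem Cx.call {φ ψ χ : Γ.carrier → α → ℕ} (hφ : Cx Γ φ) (hψ : Cx Γ ψ)
    (h : ∀ i a, Run suslinFunctional (Γ.fn i) (φ i a) (ψ i a) (χ i a)) : Cx Γ χ := by
  obtain ⟨d, hd⟩ := hφ
  obtain ⟨e, he⟩ := hψ
  obtain ⟨u, hu⟩ := exists_run_apply suslinFunctional
  exact ⟨_, fun i a => (hu _ _ _ _ (h i a)).comp ((hd i a).pair (he i a))⟩

theorem CxP.comp {p : Γ.carrier → β → Prop} (hp : CxP Γ p) {φ : Γ.carrier → α → β}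
    (hφ : Cx Γ φ) : CxP Γ fun i a => p i (φ i a) :=
  Cx.comp hp hφ

theorem CxP.of_iff {p q : Γ.carrier → α → Prop} (hp : CxP Γ p) (h : ∀ i a, p i a ↔ q i a) :
    CxP Γ q := by
  rwa [show q = p from funext₂ fun i a => propext (h i a).symm]

theorem CxP.of_primrec {p : α → Prop} (hp : PrimrecPred p) : CxP Γ fun _ a => p a := by
  classical
  exact Cx.of_primrec hp.decide

theorem CxP.rel {R : β → γ → Prop} (hR : PrimrecRel R) {φ : Γ.carrier → α → β}
    {ψ : Γ.carrier → α → γ} (hφ : Cx Γ φ) (hψ : Cx Γ ψ) :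
    CxP Γ fun i a => R (φ i a) (ψ i a) :=
  CxP.comp (p := fun _ (q : β × γ) => R q.1 q.2) (CxP.of_primrec hR) (hφ.pair hψ)

theorem CxP.not {p : Γ.carrier → α → Prop} (hp : CxP Γ p) : CxP Γ fun i a => ¬ p i a := by
  have := Cx.prim Primrec.not hp
  unfold CxP
  convert this using 3 with i a
  by_cases h : p i a <;> simp [h]

theorem CxP.and {p q : Γ.carrier → α → Prop} (hp : CxP Γ p) (hq : CxP Γ q) :
    CxP Γ fun i a => p i a ∧ q i a := by
  have := Cx.prim₂ Primrec.and hp hq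
  unfold CxP
  convert this using 3 with i a
  by_cases h : p i a <;> by_cases h' : q i a <;> simp [h, h']

theorem CxP.imp {p q : Γ.carrier → α → Prop} (hp : CxP Γ p) (hq : CxP Γ q) :
    CxP Γ fun i a => p i a → q i a :=
  (hp.and hq.not).not.of_iff fun i a => by tauto

theorem exists_run_reassoc (F : (ℕ → ℕ) → ℕ) :
    ∃ e, ∀ f a b c, Run F f e (Nat.pair (Nat.pair a b) c) (Nat.pair a (Nat.pair b c)) := by
  obtain ⟨e, he⟩ := exists_run_of_primrec F
    (g := fun x => Nat.pair x.unpair.1.unpair.1 (Nat.pair x.unpair.1.unpair.2 x.unpair.2))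
    (Primrec₂.natPair.comp
      (Primrec.fst.comp (Primrec.unpair.comp (Primrec.fst.comp Primrec.unpair)))
      (Primrec₂.natPair.comp
        (Primrec.snd.comp (Primrec.unpair.comp (Primrec.fst.comp Primrec.unpair)))
        (Primrec.snd.comp Primrec.unpair)))
  exact ⟨e, fun f a b c => by simpa using he f (Nat.pair (Nat.pair a b) c)⟩

/-- Decidable relations are closed under the Suslin quantifier. -/
theorem CxP.suslin {p : Γ.carrier → α × List ℕ → Prop} (hp : CxP Γ p) :
    CxP Γ fun i a => ∃ h : ℕ → ℕ, ∀ n, p i (a, initSeg h n) := by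
  classical
  obtain ⟨e, he⟩ := hp
  obtain ⟨s, hs⟩ := exists_run_of_primrec suslinFunctional
    (g := fun x => Nat.pair x.unpair.2 x.unpair.1)
    (Primrec₂.natPair.comp (Primrec.snd.comp Primrec.unpair) (Primrec.fst.comp Primrec.unpair))
  obtain ⟨r, hr⟩ := exists_run_reassoc suslinFunctional
  refine ⟨Nat.pair 8 (compIx (compIx e (compIx r s)) (natPairIx suslinFunctional)), fun i a => ?_⟩
  have key : ∀ n, Run suslinFunctional (Γ.fn i) (compIx e (compIx r s))
      (Nat.pair n (Nat.pair (Γ.base i) (encode a)))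
      (encode (decide (p i (a, Denumerable.ofNat (List ℕ) n)))) := by
    intro n
    refine (he i (a, Denumerable.ofNat (List ℕ) n)).comp ?_
    rw [encode_prod_val, Denumerable.encode_ofNat]
    refine (hr _ _ _ _).comp ?_
    simpa using hs (Γ.fn i) (Nat.pair n (Nat.pair (Γ.base i) (encode a)))
  have := Run.functional key
  convert this using 1
  simp only [suslinFunctional, seqNum, Denumerable.ofNat_encode]
  by_cases hh : ∃ h : ℕ → ℕ, ∀ n, p i (a, initSeg h n)
  · obtain ⟨h, hh⟩ := hh
    rw [if_pos ⟨h, fun n => by simp [hh n]⟩, decide_eq_true ⟨h, hh⟩]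
    rfl
  · rw [if_neg, decide_eq_false hh]
    · rfl
    · rintro ⟨h, h'⟩
      refine hh ⟨h, fun n => ?_⟩
      by_contra hc
      simpa [hc] using h' n

theorem initSeg_succ (h : ℕ → ℕ) (n : ℕ) : initSeg h (n + 1) = initSeg h n ++ [h n] := by
  simp [initSeg, List.range_succ]

theorem initSeg_succ_head (h : ℕ → ℕ) (n : ℕ) : (initSeg h (n + 1)).headI = h 0 := by
  simp [initSeg, List.range_succ_eq_map]

/-- A number quantifier is a Suslin quantifier in which only the first entry of the branch matters
and the empty sequence imposes no condition. -/
theorem CxP.exists_nat {p : Γ.carrier → α × ℕ → Prop} (hp : CxP Γ p) :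
    CxP Γ fun i a => ∃ n, p i (a, n) := by
  have h1 : CxP Γ fun i (x : α × List ℕ) => x.2 = [] :=
    CxP.of_primrec (Primrec.eq.comp Primrec.snd (Primrec.const []))
  have h2 : CxP Γ fun i (x : α × List ℕ) => p i (x.1, x.2.headI) :=
    hp.comp (Cx.of_primrec (Primrec.fst.pair (Primrec.list_headI.comp Primrec.snd)))
  refine (h1.not.imp h2).suslin.of_iff fun i a => ⟨fun ⟨h, hh⟩ => ⟨h 0, ?_⟩, fun ⟨n, hn⟩ =>
    ⟨fun _ => n, fun m hm => ?_⟩⟩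
  · have := hh 1 (by simp [initSeg])
    rwa [initSeg_succ_head] at this
  · cases m with
    | zero => exact absurd rfl hm
    | succ m => simpa only [initSeg_succ_head] using hn

theorem CxP.exists [Inhabited β] {p : Γ.carrier → α × β → Prop} (hp : CxP Γ p) :
    CxP Γ fun i a => ∃ b, p i (a, b) := by
  have : CxP Γ fun i (x : α × ℕ) => p i (x.1, (decode (α := β) x.2).getD default) :=
    hp.comp (Cx.of_primrec (Primrec.fst.pair
      (Primrec.option_getD.comp (Primrec.decode.comp Primrec.snd) (Primrec.const _))))
  exact this.exists_nat.of_iff fun i a => ⟨fun ⟨n, hn⟩ => ⟨_, hn⟩, fun ⟨b, hb⟩ =>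
    ⟨encode b, by simpa using hb⟩⟩

theorem CxP.forall [Inhabited β] {p : Γ.carrier → α × β → Prop} (hp : CxP Γ p) :
    CxP Γ fun i a => ∀ b, p i (a, b) :=
  hp.not.exists.not.of_iff fun i a => by simp

/-- Turns a decidable existence statement into a computable choice of witness, by unbounded search.
-/
theorem CxP.search {p : Γ.carrier → α × ℕ → Prop} (hp : CxP Γ p) (hex : ∀ i a, ∃ n, p i (a, n)) :
    ∃ φ : Γ.carrier → α → ℕ, Cx Γ φ ∧ ∀ i a, p i (a, φ i a) := by
  classical
  obtain ⟨e, he⟩ := hp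
  obtain ⟨r, hr⟩ := exists_run_reassoc suslinFunctional
  obtain ⟨t, ht⟩ := exists_run_search suslinFunctional (compIx e r)
  have key : ∀ i a, ∃ m, p i (a, m) ∧
      Run suslinFunctional (Γ.fn i) t (Nat.pair (Γ.base i) (encode a)) m := by
    intro i a
    obtain ⟨m, hm, hm'⟩ := ht (Γ.fn i) (Nat.pair (Γ.base i) (encode a))
      (fun n => decide (p i (a, n)))
      (fun n => by
        have := (he i (a, n)).comp (hr (Γ.fn i) (Γ.base i) (encode a) n)
        convert this using 1
        by_cases h : p i (a, n) <;> simp [h])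
      (by simpa using hex i a)
    exact ⟨m, by simpa using hm, hm'⟩
  choose φ hφ using key
  exact ⟨φ, ⟨t, fun i a => (hφ i a).2⟩, fun i a => (hφ i a).1⟩

end Calculus

/-! ### Clopen sets and their measures -/

open MeasureTheory
open scoped ENNReal

/-- The point of the Cantor space given by the binary digits of a number. -/
def bitPoint (i : ℕ) : Cantor := fun j => i.testBit j

/-- The clopen set with number `c`. -/
def codedClopen (c : ℕ) : Set Cantor := clopenOf ((decode₂ (List (List Bool)) c).getD [])

theorem codedClopen_encode (L : List (List Bool)) : codedClopen (encode L) = clopenOf L := by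
  simp [codedClopen]

/-- Membership of a point in `T` is determined by its first `N` coordinates. -/
def HasLevel (N : ℕ) (T : Set Cantor) : Prop :=
  ∀ x y : Cantor, (∀ j < N, x j = y j) → x ∈ T → y ∈ T

theorem HasLevel.mono {N M : ℕ} {T : Set Cantor} (h : HasLevel N T) (hNM : N ≤ M) :
    HasLevel M T := fun x y hxy => h x y fun j hj => hxy j (hj.trans_le hNM)

theorem HasLevel.compl {N : ℕ} {T : Set Cantor} (h : HasLevel N T) : HasLevel N Tᶜ :=
  fun x y hxy hx hy => hx (h y x (fun j hj => (hxy j hj).symm) hy)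

theorem HasLevel.inter {N : ℕ} {T U : Set Cantor} (hT : HasLevel N T) (hU : HasLevel N U) :
    HasLevel N (T ∩ U) := fun x y hxy hx => ⟨hT x y hxy hx.1, hU x y hxy hx.2⟩

theorem encode_le_of_mem {α : Type*} [Encodable α] {s : α} {L : List α} (h : s ∈ L) :
    encode s ≤ encode L := by
  induction L with
  | nil => simp at h
  | cons a L ih =>
    rw [encode_list_cons]
    rcases List.mem_cons.1 h with rfl | h
    · exact (Nat.left_le_pair _ _).trans (Nat.le_succ _)
    · exact (ih h).trans ((Nat.right_le_pair _ _).trans (Nat.le_succ _))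

/-- The number of a list bounds the length of each sequence in it, so `c` itself serves as a level
and none has to be computed. -/
theorem hasLevel_codedClopen (c : ℕ) : HasLevel c (codedClopen c) := by
  rintro x y hxy ⟨s, hs, hx⟩
  refine ⟨s, hs, fun i hi => ?_⟩
  rw [← hx i hi]
  refine (hxy i (hi.trans_le ?_)).symm
  cases hL : decode₂ (List (List Bool)) c with
  | none => simp [hL] at hs
  | some L =>
    rw [hL, Option.getD_some] at hs
    exact (length_le_encode s).trans ((encode_le_of_mem hs).trans (decode₂_eq_some.1 hL).le)

theorem exists_bitPoint_eq (N : ℕ) (x : Cantor) : ∃ i < 2 ^ N, ∀ j < N, x j = bitPoint i j :=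
  ⟨Nat.ofBits fun j : Fin N => x j, Nat.ofBits_lt_two_pow _, fun j hj => by
    simp [bitPoint, hj]⟩

/-- The points `bitPoint i` realize every finite pattern. Inclusion of clopen sets thus becomes a
number quantifier that does not mention the levels. -/
theorem HasLevel.subset_of_bitPoint {N M : ℕ} {T U : Set Cantor} (hT : HasLevel N T)
    (hU : HasLevel M U) (h : ∀ i, bitPoint i ∈ T → bitPoint i ∈ U) : T ⊆ U := by
  intro x hx
  obtain ⟨i, -, hi⟩ := exists_bitPoint_eq (max N M) x
  exact hU.mono (le_max_right N M) _ _ (fun j hj => (hi j hj).symm)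
    (h i (hT.mono (le_max_left N M) _ _ hi hx))

theorem HasLevel.exists_codedClopen {N : ℕ} {T : Set Cantor} (hT : HasLevel N T) :
    ∃ c, codedClopen c = T := by
  classical
  refine ⟨encode (((List.range (2 ^ N)).filter (bitPoint · ∈ T)).map
    fun i => List.ofFn fun j : Fin N => bitPoint i j), ?_⟩
  rw [codedClopen_encode]
  ext x
  constructor
  · rintro ⟨s, hs, hx⟩
    obtain ⟨i, hi, rfl⟩ := List.mem_map.1 hs
    refine hT (bitPoint i) x (fun j hj => ?_) (by simpa using (List.mem_filter.1 hi).2)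
    have := (hx j (by simpa using hj)).symm
    rwa [List.getElem_ofFn] at this
  · intro hx
    obtain ⟨i, hi, hxi⟩ := exists_bitPoint_eq N x
    refine ⟨_, List.mem_map.2 ⟨i, List.mem_filter.2 ⟨List.mem_range.2 hi, ?_⟩, rfl⟩, ?_⟩
    · simpa using hT _ _ hxi hx
    · intro j hj
      simpa using hxi j (by simpa using hj)

theorem primrec_two_pow : Primrec fun n : ℕ => 2 ^ n :=
  (Primrec₂.unpaired'.1 Nat.Primrec.pow).comp (Primrec.const 2) Primrec.id

theorem primrec_testBit : Primrec₂ Nat.testBit := by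
  have : PrimrecRel fun i j : ℕ => i / 2 ^ j % 2 = 1 :=
    Primrec.eq.comp (Primrec.nat_mod.comp (Primrec.nat_div.comp Primrec.fst
      (primrec_two_pow.comp Primrec.snd)) (Primrec.const 2)) (Primrec.const 1)
  exact this.decide.of_eq fun i j => by rw [Nat.testBit_eq_decide_div_mod_eq]

theorem primrecRel_bitPoint_mem : PrimrecRel fun c i : ℕ => bitPoint i ∈ codedClopen c := by
  have h1 : PrimrecRel fun (j : ℕ) (p : List Bool × ℕ) => p.1[j]? = some (p.2.testBit j) :=
    Primrec.eq.comp
      (Primrec.list_getElem?.comp (Primrec.fst.comp Primrec.snd) Primrec.fst)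
      (Primrec.option_some.comp (primrec_testBit.comp (Primrec.snd.comp Primrec.snd) Primrec.fst))
  have h2 : PrimrecRel fun (s : List Bool) (i : ℕ) => ∀ j < s.length, s[j]? = some (i.testBit j) :=
    (PrimrecRel.comp h1.forall_mem_list (f := fun p : List Bool × ℕ => List.range p.1.length)
      (Primrec.list_range.comp (Primrec.list_length.comp Primrec.fst)) Primrec.id).of_eq
      fun p => by simp
  have h3 := PrimrecRel.comp h2.exists_mem_list
    (f := fun p : ℕ × ℕ => (decode₂ (List (List Bool)) p.1).getD [])
    (Primrec.option_getD.comp (Primrec.decode₂.comp Primrec.fst) (Primrec.const [])) Primrec.snd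
  refine h3.of_eq fun p => ?_
  refine exists_congr fun s => and_congr_right fun _ => forall₂_congr fun j hj => ?_
  rw [List.getElem?_eq_getElem hj, Option.some_inj, bitPoint]
  exact eq_comm

open Classical in
/-- The number of the strings of length `c` that meet the clopen set with number `c`. -/
noncomputable def bitCount (c : ℕ) : ℕ :=
  ((List.range (2 ^ c)).filter fun i => bitPoint i ∈ codedClopen c).length

theorem primrec_bitCount : Primrec bitCount := by
  classical
  have := (PrimrecRel.listFilter primrecRel_bitPoint_mem.swap).comp
    (Primrec.list_range.comp primrec_two_pow) Primrec.id
  exact Primrec.list_length.comp this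

instance : IsProbabilityMeasure cantorMeasure := by
  unfold cantorMeasure
  infer_instance

/-- The basic clopen set of the points that begin with the first `N` digits of `i`. -/
def bitCylinder (N i : ℕ) : Set Cantor := {x | ∀ j < N, x j = bitPoint i j}

theorem measurableSet_bitCylinder (N i : ℕ) : MeasurableSet (bitCylinder N i) := by
  have : bitCylinder N i = (Finset.range N : Set ℕ).pi fun j => {bitPoint i j} := by
    ext x; simp [bitCylinder, Set.mem_pi]
  rw [this]
  exact MeasurableSet.pi (Finset.countable_toSet _) fun _ _ => MeasurableSet.singleton _

theorem cantorMeasure_bitCylinder (N i : ℕ) : cantorMeasure (bitCylinder N i) = (2⁻¹) ^ N := by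
  have : bitCylinder N i = (Finset.range N : Set ℕ).pi fun j => {bitPoint i j} := by
    ext x; simp [bitCylinder, Set.mem_pi]
  rw [this, cantorMeasure, Measure.infinitePi_pi _ fun _ _ => MeasurableSet.singleton _]
  simp

theorem HasLevel.eq_iUnion_bitCylinder {N : ℕ} {T : Set Cantor} (hT : HasLevel N T)
    (s : Finset ℕ) (hs : ∀ i, i ∈ s ↔ i < 2 ^ N ∧ bitPoint i ∈ T) :
    T = ⋃ i ∈ s, bitCylinder N i := by
  ext x
  simp only [Set.mem_iUnion, exists_prop, hs]
  constructor
  · intro hx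
    obtain ⟨i, hi, hxi⟩ := exists_bitPoint_eq N x
    exact ⟨i, ⟨hi, hT _ _ hxi hx⟩, hxi⟩
  · rintro ⟨i, ⟨-, hi⟩, hx⟩
    exact hT _ _ (fun j hj => (hx j hj).symm) hi

theorem HasLevel.measurableSet {N : ℕ} {T : Set Cantor} (hT : HasLevel N T) :
    MeasurableSet T := by
  classical
  rw [hT.eq_iUnion_bitCylinder ((Finset.range (2 ^ N)).filter (bitPoint · ∈ T)) (by simp)]
  exact Finset.measurableSet_biUnion _ fun i _ => measurableSet_bitCylinder N i

theorem measurableSet_codedClopen (c : ℕ) : MeasurableSet (codedClopen c) :=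
  (hasLevel_codedClopen c).measurableSet

theorem cantorMeasure_codedClopen (c : ℕ) :
    cantorMeasure (codedClopen c) = bitCount c * (2⁻¹) ^ c := by
  classical
  set s := (Finset.range (2 ^ c)).filter (bitPoint · ∈ codedClopen c) with hs
  have hcard : bitCount c = s.card := rfl
  rw [(hasLevel_codedClopen c).eq_iUnion_bitCylinder s (by simp [hs]),
    measure_biUnion_finset _ fun i _ => measurableSet_bitCylinder c i]
  · simp [cantorMeasure_bitCylinder, hcard]
  · intro i hi k hk hik
    refine Set.disjoint_left.2 fun x hx hx' => hik (Nat.eq_of_testBit_eq fun j => ?_)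
    rcases lt_or_ge j c with hj | hj
    · exact (hx j hj).symm.trans (hx' j hj)
    · have h1 : i < 2 ^ c := by simpa using (Finset.mem_filter.1 hi).1
      have h2 : k < 2 ^ c := by simpa using (Finset.mem_filter.1 hk).1
      have h3 : 2 ^ c ≤ 2 ^ j := Nat.pow_le_pow_right two_pos hj
      rw [Nat.testBit_lt_two_pow (h1.trans_le h3), Nat.testBit_lt_two_pow (h2.trans_le h3)]

theorem cantorMeasure_real_codedClopen (c : ℕ) :
    cantorMeasure.real (codedClopen c) = bitCount c / 2 ^ c := by
  rw [measureReal_def, cantorMeasure_codedClopen]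
  simp [div_eq_mul_inv]

open scoped symmDiff

/-! ### Approximation in measure -/

section Approximation

variable {P : Set Cantor}

/-- Borel-Cantelli: the errors are summable, so almost every point lies in only finitely many `P ∆ T
k`, and `P` agrees almost everywhere with the limsup of the `T k`. Up to that point the measure of
`P` is only an outer measure. -/
theorem nullMeasurableSet_of_approx {T : ℕ → Set Cantor} (hT : ∀ k, MeasurableSet (T k))
    (h : ∀ k, cantorMeasure (P ∆ T k) ≤ 2⁻¹ ^ k) : NullMeasurableSet P cantorMeasure := by
  have hsum : ∑' k, cantorMeasure (P ∆ T k) ≠ ∞ := by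
    refine ne_top_of_le_ne_top ?_ (ENNReal.tsum_le_tsum h)
    rw [ENNReal.tsum_geometric_two]
    exact ENNReal.ofNat_ne_top
  have h0 := measure_limsup_atTop_eq_zero hsum
  have hsub : P ∆ Filter.limsup T Filter.atTop ⊆
      Filter.limsup (fun k => P ∆ T k) Filter.atTop := by
    intro x hx
    rw [Filter.limsup_eq_iInf_iSup_of_nat] at hx ⊢
    simp only [Set.iInf_eq_iInter, Set.iSup_eq_iUnion, Set.mem_symmDiff, Set.mem_iInter,
      Set.mem_iUnion, exists_prop] at hx ⊢
    rcases hx with ⟨hxP, hx⟩ | ⟨hx, hxP⟩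
    · push Not at hx
      obtain ⟨n, hn⟩ := hx
      exact fun m => ⟨max m n, le_max_left _ _, Or.inl ⟨hxP, hn _ (le_max_right _ _)⟩⟩
    · exact fun m => (hx m).imp fun k hk => ⟨hk.1, Or.inr ⟨hk.2, hxP⟩⟩
  have hT' : MeasurableSet (Filter.limsup T Filter.atTop) := MeasurableSet.measurableSet_limsup hT
  exact hT'.nullMeasurableSet.congr
    (measure_symmDiff_eq_zero_iff.1 (measure_mono_null hsub h0)).symm

theorem measure_le_add_symmDiff (A B : Set Cantor) :
    cantorMeasure.real A ≤ cantorMeasure.real B + cantorMeasure.real (A ∆ B) := by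
  refine (measureReal_mono (s₂ := B ∪ A ∆ B) fun x hx => ?_).trans (measureReal_union_le _ _)
  by_cases hB : x ∈ B
  · exact Or.inl hB
  · exact Or.inr (Or.inl ⟨hx, hB⟩)

theorem lt_measure_iff_of_approx {T : ℕ → Set Cantor}
    (h : ∀ k, cantorMeasure (P ∆ T k) ≤ 2⁻¹ ^ k) (q : ℝ) :
    q < cantorMeasure.real P ↔ ∃ k, q + 2⁻¹ ^ k < cantorMeasure.real (T k) := by
  have h' : ∀ k, cantorMeasure.real (P ∆ T k) ≤ 2⁻¹ ^ k := fun k => by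
    refine (ENNReal.toReal_mono (by simp) (h k)).trans_eq ?_
    simp
  constructor
  · intro hq
    obtain ⟨k, hk⟩ := exists_pow_lt_of_lt_one (half_pos (sub_pos.2 hq))
      (show (2⁻¹ : ℝ) < 1 by norm_num)
    refine ⟨k, ?_⟩
    have := measure_le_add_symmDiff P (T k)
    linarith [h' k]
  · rintro ⟨k, hk⟩
    have := measure_le_add_symmDiff (T k) P
    rw [symmDiff_comm] at this
    linarith [h' k]

theorem suslinOp_symmDiff_subset (P Q : List ℕ → Set Cantor) :
    suslinOp P ∆ suslinOp Q ⊆ ⋃ s, P s ∆ Q s := by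
  intro x hx
  simp only [suslinOp, Set.mem_symmDiff, Set.mem_iUnion, Set.mem_iInter] at hx ⊢
  rcases hx with ⟨⟨f, hf⟩, hx⟩ | ⟨⟨f, hf⟩, hx⟩ <;> push Not at hx <;> obtain ⟨n, hn⟩ := hx f
  · exact ⟨_, Or.inl ⟨hf n, hn⟩⟩
  · exact ⟨_, Or.inr ⟨hf n, hn⟩⟩

/-- A point in only one of the two values lies in some `P s ∆ Q s`, and the sequence numbers being
distinct, the errors add up to at most a geometric series. -/
theorem measure_suslinOp_symmDiff_le {P Q : List ℕ → Set Cantor} {k : ℕ}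
    (h : ∀ s, cantorMeasure (P s ∆ Q s) ≤ 2⁻¹ ^ (k + 1 + encode s)) :
    cantorMeasure (suslinOp P ∆ suslinOp Q) ≤ 2⁻¹ ^ k := by
  calc cantorMeasure (suslinOp P ∆ suslinOp Q)
      ≤ cantorMeasure (⋃ s, P s ∆ Q s) := measure_mono (suslinOp_symmDiff_subset P Q)
    _ ≤ ∑' s, cantorMeasure (P s ∆ Q s) := measure_iUnion_le _
    _ ≤ ∑' s : List ℕ, (2⁻¹ : ℝ≥0∞) ^ (k + 1 + encode s) := ENNReal.tsum_le_tsum h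
    _ ≤ ∑' n : ℕ, (2⁻¹ : ℝ≥0∞) ^ (k + 1 + n) :=
      ENNReal.tsum_comp_le_tsum_of_injective encode_injective
        fun n => (2⁻¹ : ℝ≥0∞) ^ (k + 1 + n)
    _ = 2⁻¹ ^ k := by
      simp_rw [pow_add _ (k + 1)]
      rw [ENNReal.tsum_mul_left, ENNReal.tsum_geometric_two, pow_succ, mul_assoc,
        ENNReal.inv_mul_cancel (by simp) (by simp), mul_one]

end Approximation

/-! ### Suslin schemes of clopen sets: bounded stages and compactness -/

section Stages

variable (d : List ℕ → ℕ)

/-- The points that belong to a branch of length `s.length` of the scheme `d` of clopen sets that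
is bounded by `s`. -/
def stage (s : List ℕ) : Set Cantor :=
  {x | ∃ t : List ℕ, (t.length = s.length ∧ ∀ j, t.getD j 0 ≤ s.getD j 0) ∧
    ∀ m, x ∈ codedClopen (d (t.take m))}

theorem initSeg_length (f : ℕ → ℕ) (n : ℕ) : (initSeg f n).length = n := by simp [initSeg]

theorem initSeg_take (f : ℕ → ℕ) (n m : ℕ) : (initSeg f n).take m = initSeg f (min m n) := by
  simp [initSeg, ← List.map_take, List.take_range]

theorem initSeg_getD (f : ℕ → ℕ) (n j : ℕ) :
    (initSeg f n).getD j 0 = if j < n then f j else 0 := by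
  simp only [initSeg, List.getD_eq_getElem?_getD, List.getElem?_map]
  split_ifs with h <;> simp [h]

theorem initSeg_getD_length (t : List ℕ) : initSeg (fun j => t.getD j 0) t.length = t := by
  refine List.ext_getElem (initSeg_length _ _) fun j h1 h2 => ?_
  simp [initSeg, List.getElem?_eq_getElem h2]

variable {d}

/-- Extending finite branches by zeros places the witnesses for all `n` in the one compact set of
functions below `h`. -/
theorem mem_stage_initSeg {h : ℕ → ℕ} {n : ℕ} {x : Cantor} :
    x ∈ stage d (initSeg h n) ↔
      ∃ f : ℕ → ℕ, (∀ j, f j ≤ h j) ∧ ∀ m ≤ n, x ∈ codedClopen (d (initSeg f m)) := by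
  constructor
  · rintro ⟨t, ⟨ht, hle⟩, hx⟩
    rw [initSeg_length] at ht
    refine ⟨fun j => t.getD j 0, fun j => (hle j).trans ?_, fun m hm => ?_⟩
    · rw [initSeg_getD]
      split_ifs <;> simp
    · have := hx m
      rwa [← initSeg_getD_length t, initSeg_take, ht, min_eq_left hm] at this
  · rintro ⟨f, hf, hx⟩
    refine ⟨initSeg f n, ⟨by simp [initSeg_length], fun j => ?_⟩, fun m => ?_⟩
    · rw [initSeg_getD, initSeg_getD]
      split_ifs
      · exact hf j
      · exact le_rfl
    · rw [initSeg_take]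
      exact hx _ (min_le_right _ _)

theorem stage_initSeg_antitone (h : ℕ → ℕ) : Antitone fun n => stage d (initSeg h n) := by
  intro n m hnm x hx
  obtain ⟨f, hf, hx⟩ := mem_stage_initSeg.1 hx
  exact mem_stage_initSeg.2 ⟨f, hf, fun j hj => hx j (hj.trans hnm)⟩

theorem exists_bound_initSeg (h : ℕ → ℕ) (n : ℕ) :
    ∀ φ : List ℕ → ℕ, ∃ N, ∀ f : ℕ → ℕ, (∀ j, f j ≤ h j) → φ (initSeg f n) ≤ N := by
  induction n with
  | zero => exact fun φ => ⟨φ [], fun f _ => le_rfl⟩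
  | succ n ih =>
    intro φ
    obtain ⟨N, hN⟩ := ih fun l => (Finset.range (h n + 1)).sup fun k => φ (l ++ [k])
    refine ⟨N, fun f hf => le_trans ?_ (hN f hf)⟩
    rw [initSeg_succ]
    exact Finset.le_sup (f := fun k => φ (initSeg f n ++ [k]))
      (Finset.mem_range.2 (Nat.lt_succ_of_le (hf n)))

theorem exists_hasLevel_stage (h : ℕ → ℕ) (n : ℕ) :
    ∃ N, HasLevel N (stage d (initSeg h n)) := by
  choose N hN using fun m => exists_bound_initSeg h m d
  refine ⟨(Finset.range (n + 1)).sup N, fun x y hxy hx => ?_⟩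
  obtain ⟨f, hf, hx⟩ := mem_stage_initSeg.1 hx
  refine mem_stage_initSeg.2 ⟨f, hf, fun m hm => ?_⟩
  refine ((hasLevel_codedClopen _).mono ?_) x y hxy (hx m hm)
  exact (hN m f hf).trans (Finset.le_sup (Finset.mem_range.2 (Nat.lt_succ_of_le hm)))

theorem measurableSet_stage (h : ℕ → ℕ) (n : ℕ) : MeasurableSet (stage d (initSeg h n)) :=
  (exists_hasLevel_stage h n).choose_spec.measurableSet

/-- The points that belong to all stages below a bound belong to a branch. -/
theorem iInter_stage_subset (h : ℕ → ℕ) :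
    ⋂ n, stage d (initSeg h n) ⊆ suslinOp fun s => codedClopen (d s) := by
  intro x hx
  have hclosed : ∀ (m : ℕ) (Z : Set (List ℕ)), IsClosed {f : ℕ → ℕ | initSeg f m ∈ Z} := by
    intro m Z
    have hc : Continuous fun (f : ℕ → ℕ) (i : Fin m) => f i := by fun_prop
    have := (isClosed_discrete {g : Fin m → ℕ | List.ofFn g ∈ Z}).preimage hc
    convert this using 1
    ext f
    simp [initSeg, List.ofFn_eq_map, ← List.map_coe_finRange_eq_range, Function.comp_def]
  have hcompact : IsCompact {f : ℕ → ℕ | ∀ j, f j ≤ h j} := by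
    convert isCompact_univ_pi fun j => (Set.finite_Iic (h j)).isCompact using 1
    ext f
    simp [Pi.le_def]
  have hK : ∀ n, IsClosed {f : ℕ → ℕ | (∀ j, f j ≤ h j) ∧
      ∀ m ≤ n, x ∈ codedClopen (d (initSeg f m))} := by
    intro n
    convert hcompact.isClosed.inter (isClosed_iInter fun m => isClosed_iInter fun _ : m ≤ n =>
      hclosed m {s | x ∈ codedClopen (d s)}) using 1
    ext f
    simp
  -- Cantor's intersection theorem: the sets of functions below `h` that are good up to `n` are
  -- nonempty, compact and decreasing.
  obtain ⟨f, hf⟩ := IsCompact.nonempty_iInter_of_sequence_nonempty_isCompact_isClosed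
    (fun n => {f : ℕ → ℕ | (∀ j, f j ≤ h j) ∧ ∀ m ≤ n, x ∈ codedClopen (d (initSeg f m))})
    (fun n f hf => ⟨hf.1, fun m hm => hf.2 m (hm.trans (Nat.le_succ n))⟩)
    (fun n => mem_stage_initSeg.1 (Set.mem_iInter.1 hx n))
    (hcompact.of_isClosed_subset (hK 0) fun f hf => hf.1) hK
  exact Set.mem_iUnion.2 ⟨f, Set.mem_iInter.2 fun n => (Set.mem_iInter.1 hf n).2 n le_rfl⟩

/-- The points of the value of the Suslin operator that have a branch whose beginning is bounded
by `s`. -/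
def boundedBranches (d : List ℕ → ℕ) (s : List ℕ) : Set Cantor :=
  {x | ∃ f : ℕ → ℕ, (∀ j < s.length, f j ≤ s.getD j 0) ∧ ∀ m, x ∈ codedClopen (d (initSeg f m))}

theorem boundedBranches_nil :
    boundedBranches d [] = suslinOp fun s => codedClopen (d s) := by
  ext x
  simp [boundedBranches, suslinOp]

theorem boundedBranches_eq_iUnion (s : List ℕ) :
    boundedBranches d s = ⋃ k, boundedBranches d (s ++ [k]) := by
  ext x
  simp only [boundedBranches, Set.mem_ofPred_eq, Set.mem_iUnion, List.length_append,
    List.length_singleton]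
  constructor
  · rintro ⟨f, hf, hx⟩
    refine ⟨f s.length, f, fun j hj => ?_, hx⟩
    rcases Nat.lt_succ_iff_lt_or_eq.1 hj with hj | rfl
    · rw [List.getD_append _ _ _ _ hj]
      exact hf j hj
    · simp
  · rintro ⟨k, f, hf, hx⟩
    refine ⟨f, fun j hj => ?_, hx⟩
    have := hf j (by omega)
    rwa [List.getD_append _ _ _ _ hj] at this

theorem boundedBranches_monotone (s : List ℕ) :
    Monotone fun k => boundedBranches d (s ++ [k]) := by
  rintro k l hkl x ⟨f, hf, hx⟩
  refine ⟨f, fun j hj => (hf j (by simpa using hj)).trans ?_, hx⟩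
  simp only [List.length_append, List.length_singleton] at hj
  rcases Nat.lt_succ_iff_lt_or_eq.1 hj with hj | rfl
  · rw [List.getD_append _ _ _ _ hj, List.getD_append _ _ _ _ hj]
  · simpa using hkl

theorem boundedBranches_initSeg_subset (h : ℕ → ℕ) (n : ℕ) :
    boundedBranches d (initSeg h n) ⊆ stage d (initSeg h n) := by
  rintro x ⟨f, hf, hx⟩
  rw [initSeg_length] at hf
  refine ⟨initSeg f n, ⟨by simp [initSeg_length], fun j => ?_⟩, fun m => ?_⟩
  · rw [initSeg_getD]
    split_ifs with hj
    · exact hf j hj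
    · exact Nat.zero_le _
  · rw [initSeg_take]
    exact hx _

/-- The bounds are chosen one entry at a time: the sets `boundedBranches d (s ++ [k])` increase with
`k` to `boundedBranches d s`, and continuity from below holds without measurability. -/
theorem exists_lt_measure_stage {q : ℝ≥0∞}
    (hq : q < cantorMeasure (suslinOp fun s => codedClopen (d s))) :
    ∃ h : ℕ → ℕ, ∀ n, q < cantorMeasure (stage d (initSeg h n)) := by
  have step : ∀ s, ∃ k, q < cantorMeasure (boundedBranches d s) →
      q < cantorMeasure (boundedBranches d (s ++ [k])) := by
    intro s
    by_cases hs : q < cantorMeasure (boundedBranches d s)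
    · have hs' := hs
      rw [boundedBranches_eq_iUnion, (boundedBranches_monotone s).measure_iUnion,
        lt_iSup_iff] at hs'
      exact hs'.imp fun k hk _ => hk
    · exact ⟨0, fun h => absurd h hs⟩
  choose k hk using step
  let l : ℕ → List ℕ := Nat.rec [] fun _ s => s ++ [k s]
  refine ⟨fun n => k (l n), fun n => ?_⟩
  have hl : ∀ n, initSeg (fun n => k (l n)) n = l n := by
    intro n
    induction n with
    | zero => rfl
    | succ n ih => rw [initSeg_succ, ih]
  refine lt_of_lt_of_le ?_ (measure_mono (boundedBranches_initSeg_subset _ n))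
  rw [hl]
  induction n with
  | zero => rwa [show l 0 = [] from rfl, boundedBranches_nil]
  | succ n ih => exact hk _ ih

variable (d) in
/-- The stage bounded by `s` meets the clopen set with number `c` in a set of measure at least
`i / 2 ^ k`, expressed without reference to measures of infinite sets. -/
def StageLE (k i c : ℕ) (s : List ℕ) : Prop :=
  ∀ c', (∀ j, bitPoint j ∈ stage d s → bitPoint j ∈ codedClopen c → bitPoint j ∈ codedClopen c') →
    i * 2 ^ c' ≤ bitCount c' * 2 ^ k

theorem mul_pow_le_cantorMeasure_iff {k i c : ℕ} :
    (i : ℝ≥0∞) * 2⁻¹ ^ k ≤ cantorMeasure (codedClopen c) ↔ i * 2 ^ c ≤ bitCount c * 2 ^ k := by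
  rw [cantorMeasure_codedClopen, ← ENNReal.inv_pow, ← ENNReal.inv_pow, ← div_eq_mul_inv,
    ← div_eq_mul_inv, ENNReal.div_le_iff (by simp) (by simp), ← ENNReal.mul_div_right_comm,
    ENNReal.le_div_iff_mul_le (by simp) (by simp)]
  exact_mod_cast Iff.rfl

theorem cantorMeasure_le_mul_pow_iff {k i c : ℕ} :
    cantorMeasure (codedClopen c) ≤ (i : ℝ≥0∞) * 2⁻¹ ^ k ↔ bitCount c * 2 ^ k ≤ i * 2 ^ c := by
  rw [cantorMeasure_codedClopen, ← ENNReal.inv_pow, ← ENNReal.inv_pow, ← div_eq_mul_inv,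
    ← div_eq_mul_inv, ENNReal.div_le_iff (by simp) (by simp), ← ENNReal.mul_div_right_comm,
    ENNReal.le_div_iff_mul_le (by simp) (by simp)]
  exact_mod_cast Iff.rfl

/-- The intersection is itself clopen, hence the least of the coded clopen sets that contain it; a
lower bound for all of these is a lower bound for its measure. -/
theorem stageLE_initSeg_iff {k i c n : ℕ} {h : ℕ → ℕ} :
    StageLE d k i c (initSeg h n) ↔
      (i : ℝ≥0∞) * 2⁻¹ ^ k ≤ cantorMeasure (stage d (initSeg h n) ∩ codedClopen c) := by
  obtain ⟨N, hN⟩ := exists_hasLevel_stage (d := d) h n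
  have hM := (hN.mono (le_max_left N c)).inter
    ((hasLevel_codedClopen c).mono (le_max_right N c))
  constructor
  · intro H
    obtain ⟨c', hc'⟩ := hM.exists_codedClopen
    rw [← hc', mul_pow_le_cantorMeasure_iff]
    exact H c' fun j hj hj' => hc' ▸ ⟨hj, hj'⟩
  · intro H c' hc'
    rw [← mul_pow_le_cantorMeasure_iff]
    exact H.trans (measure_mono (hM.subset_of_bitPoint (hasLevel_codedClopen c')
      fun j hj => hc' j hj.1 hj.2))

/-- The number of the whole Cantor space. -/
def univCode : ℕ := encode ([[]] : List (List Bool))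

theorem codedClopen_univCode : codedClopen univCode = Set.univ := by
  rw [univCode, codedClopen_encode]
  ext x
  simp [clopenOf]

variable (d) in
/-- `c` is the number of a clopen set that is near the value of the Suslin operator, and `i`
witnesses this. -/
def IsNear (k i c : ℕ) : Prop :=
  (∃ h : ℕ → ℕ, ∀ n, StageLE d k i c (initSeg h n)) ∧ bitCount c * 2 ^ k ≤ (i + 2) * 2 ^ c ∧
    ¬ ∃ h : ℕ → ℕ, ∀ n, StageLE d k (i + 1) univCode (initSeg h n)

theorem measure_iInter_stage_inter {k i c : ℕ} {h : ℕ → ℕ}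
    (H : ∀ n, StageLE d k i c (initSeg h n)) :
    (i : ℝ≥0∞) * 2⁻¹ ^ k ≤ cantorMeasure ((⋂ n, stage d (initSeg h n)) ∩ codedClopen c) := by
  rw [Set.iInter_inter, Antitone.measure_iInter]
  · exact le_iInf fun n => stageLE_initSeg_iff.1 (H n)
  · exact fun n m hnm => Set.inter_subset_inter_left _ (stage_initSeg_antitone h hnm)
  · exact fun n => ((measurableSet_stage h n).inter (measurableSet_codedClopen c)).nullMeasurableSet
  · exact ⟨0, measure_ne_top _ _⟩

/-- Write `A` for the Suslin value, `L` for the clopen set and `K ⊆ A` for the intersection of the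
stages. Since `m(K ∩ L) ≥ i / 2 ^ k`, the bounds `m(A) ≤ (i + 1) / 2 ^ k` and `m(L) ≤ (i + 2) / 2 ^
k` leave at most `1 / 2 ^ k` for `A \ L` and `2 / 2 ^ k` for `L \ A`. Only `K` and `L` need to be
measurable. -/
theorem IsNear.measure_symmDiff_le {k i c : ℕ} (hn : IsNear d k i c) :
    cantorMeasure ((suslinOp fun s => codedClopen (d s)) ∆ codedClopen c) ≤ 3 * 2⁻¹ ^ k := by
  obtain ⟨⟨h, hh⟩, hc, hi⟩ := hn
  set A := suslinOp fun s => codedClopen (d s)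
  set K := (⋂ n, stage d (initSeg h n)) with hK
  set L := codedClopen c
  have hL : MeasurableSet L := measurableSet_codedClopen c
  have hKm : MeasurableSet K := MeasurableSet.iInter fun n => measurableSet_stage h n
  have hKA : K ⊆ A := iInter_stage_subset h
  have hKL : (i : ℝ≥0∞) * 2⁻¹ ^ k ≤ cantorMeasure (K ∩ L) := measure_iInter_stage_inter hh
  have hA : cantorMeasure A ≤ ((i + 1 : ℕ) : ℝ≥0∞) * 2⁻¹ ^ k := by
    by_contra hlt
    obtain ⟨g, hg⟩ := exists_lt_measure_stage (not_le.1 hlt)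
    refine hi ⟨g, fun n => stageLE_initSeg_iff.2 ?_⟩
    rw [codedClopen_univCode, Set.inter_univ]
    exact (hg n).le
  have hLm : cantorMeasure L ≤ ((i + 2 : ℕ) : ℝ≥0∞) * 2⁻¹ ^ k :=
    cantorMeasure_le_mul_pow_iff.2 hc
  have hfin : (i : ℝ≥0∞) * 2⁻¹ ^ k ≠ ∞ := ENNReal.mul_ne_top (by simp) (by simp)
  have h1 : cantorMeasure (A \ L) ≤ 2⁻¹ ^ k := by
    refine (ENNReal.add_le_add_iff_left hfin).1 ?_
    calc (i : ℝ≥0∞) * 2⁻¹ ^ k + cantorMeasure (A \ L)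
        ≤ cantorMeasure (A ∩ L) + cantorMeasure (A \ L) := by
          gcongr
          exact hKL.trans (measure_mono (Set.inter_subset_inter_left _ hKA))
      _ = cantorMeasure A := measure_inter_add_sdiff A hL
      _ ≤ _ := hA
      _ = _ := by push_cast; ring
  have h2 : cantorMeasure (L \ A) ≤ 2 * 2⁻¹ ^ k := by
    refine (ENNReal.add_le_add_iff_left hfin).1 ?_
    calc (i : ℝ≥0∞) * 2⁻¹ ^ k + cantorMeasure (L \ A)
        ≤ cantorMeasure (L ∩ K) + cantorMeasure (L \ K) := by
          gcongr
          rwa [Set.inter_comm]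
      _ = cantorMeasure L := measure_inter_add_sdiff L hKm
      _ ≤ _ := hLm
      _ = _ := by push_cast; ring
  calc cantorMeasure (A ∆ L) ≤ cantorMeasure (A \ L) + cantorMeasure (L \ A) :=
        measure_union_le _ _
    _ ≤ 2⁻¹ ^ k + 2 * 2⁻¹ ^ k := add_le_add h1 h2
    _ = 3 * 2⁻¹ ^ k := by ring

variable (d) in
-- Take `i` such that the bound `i / 2 ^ k` is attained along some `h` and `(i + 1) / 2 ^ k` along
-- none. The stages of `h` decrease to a set of measure at most `(i + 1) / 2 ^ k`, so some stage has
-- measure below `(i + 2) / 2 ^ k`; that stage is the clopen set. The slack of one unit makes the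
-- inequality strict.
theorem exists_isNear (k : ℕ) : ∃ i c, IsNear d k i c := by
  classical
  set V : ℕ → Prop := fun i => ∃ h : ℕ → ℕ, ∀ n, StageLE d k i univCode (initSeg h n) with hV
  have hV' : ∀ i, V i → i ≤ 2 ^ k := by
    rintro i ⟨h, hh⟩
    have h1 := stageLE_initSeg_iff.1 (hh 0)
    have h2 := (h1.trans prob_le_one)
    rw [← ENNReal.inv_pow, ← div_eq_mul_inv, ENNReal.div_le_iff (by simp) (by simp),
      one_mul] at h2
    exact_mod_cast h2
  have hV0 : V 0 := ⟨0, fun n c' _ => by simp⟩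
  obtain ⟨i, hi, hi'⟩ : ∃ i, V i ∧ ¬ V (i + 1) := by
    by_contra hcon
    push Not at hcon
    have : ∀ i, V i := fun i => Nat.rec hV0 hcon i
    exact absurd (hV' _ (this (2 ^ k + 1))) (by omega)
  obtain ⟨h, hh⟩ := hi
  have hA : cantorMeasure (⋂ n, stage d (initSeg h n)) ≤ ((i + 1 : ℕ) : ℝ≥0∞) * 2⁻¹ ^ k := by
    refine (measure_mono (iInter_stage_subset h)).trans ?_
    by_contra hlt
    obtain ⟨g, hg⟩ := exists_lt_measure_stage (not_le.1 hlt)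
    refine hi' ⟨g, fun n => stageLE_initSeg_iff.2 ?_⟩
    rw [codedClopen_univCode, Set.inter_univ]
    exact (hg n).le
  have hlt : cantorMeasure (⋂ n, stage d (initSeg h n)) <
      ((i + 2 : ℕ) : ℝ≥0∞) * 2⁻¹ ^ k := by
    refine hA.trans_lt (ENNReal.mul_lt_mul_left (by simp) (by simp) ?_)
    exact_mod_cast Nat.lt_succ_self _
  rw [Antitone.measure_iInter (stage_initSeg_antitone h)
    (fun n => (measurableSet_stage h n).nullMeasurableSet) ⟨0, measure_ne_top _ _⟩,
    iInf_lt_iff] at hlt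
  obtain ⟨n, hn⟩ := hlt
  obtain ⟨N, hN⟩ := exists_hasLevel_stage (d := d) h n
  obtain ⟨c, hc⟩ := hN.exists_codedClopen
  refine ⟨i, c, ⟨h, fun m => stageLE_initSeg_iff.2 ?_⟩, ?_, hi'⟩
  · have h1 := stageLE_initSeg_iff.1 (hh (max m n))
    refine h1.trans (measure_mono fun x hx => ⟨?_, ?_⟩)
    · exact stage_initSeg_antitone h (le_max_left m n) hx.1
    · rw [hc]
      exact stage_initSeg_antitone h (le_max_right m n) hx.1
  · rw [← cantorMeasure_le_mul_pow_iff, hc]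
    exact hn.le

end Stages

/-! ### Deciding nearness in the Suslin functional -/

section Decidability

variable {Γ : Context} {α : Type} [Primcodable α]

theorem CxP.bitPoint_mem {φ ψ : Γ.carrier → α → ℕ} (hφ : Cx Γ φ) (hψ : Cx Γ ψ) :
    CxP Γ fun i a => bitPoint (φ i a) ∈ codedClopen (ψ i a) :=
  CxP.rel (R := fun c i => bitPoint i ∈ codedClopen c) primrecRel_bitPoint_mem hψ hφ

variable {d : Γ.carrier → List ℕ → ℕ}

theorem CxP.stage_mem (hd : Cx Γ d) :
    CxP Γ fun x (a : List ℕ × ℕ) => bitPoint a.2 ∈ stage (d x) a.1 := by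
  have h1 : CxP Γ fun _ (a : (List ℕ × ℕ) × List ℕ) => a.2.length = a.1.1.length :=
    CxP.of_primrec (Primrec.eq.comp (Primrec.list_length.comp Primrec.snd)
      (Primrec.list_length.comp (Primrec.fst.comp Primrec.fst)))
  have h2 : CxP Γ fun _ (a : ((List ℕ × ℕ) × List ℕ) × ℕ) =>
      a.1.2.getD a.2 0 ≤ a.1.1.1.getD a.2 0 :=
    CxP.of_primrec (Primrec.nat_le.comp
      ((Primrec.list_getD 0).comp (Primrec.snd.comp Primrec.fst) Primrec.snd)
      ((Primrec.list_getD 0).comp (Primrec.fst.comp (Primrec.fst.comp Primrec.fst)) Primrec.snd))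
  have h3 : CxP Γ fun x (a : ((List ℕ × ℕ) × List ℕ) × ℕ) =>
      bitPoint a.1.1.2 ∈ codedClopen (d x (a.1.2.take a.2)) :=
    CxP.bitPoint_mem
      (Cx.of_primrec (Primrec.snd.comp (Primrec.fst.comp Primrec.fst)))
      (hd.comp (Cx.of_primrec
        (Primrec.list_take.comp Primrec.snd (Primrec.snd.comp Primrec.fst))))
  exact ((h1.and h2.forall).and h3.forall).exists

theorem CxP.stageLE (hd : Cx Γ d) :
    CxP Γ fun x (a : ((ℕ × ℕ) × ℕ) × List ℕ) => StageLE (d x) a.1.1.1 a.1.1.2 a.1.2 a.2 := by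
  have h1 : CxP Γ fun x (a : ((((ℕ × ℕ) × ℕ) × List ℕ) × ℕ) × ℕ) =>
      bitPoint a.2 ∈ stage (d x) a.1.1.2 :=
    (CxP.stage_mem hd).comp (Cx.of_primrec
      ((Primrec.snd.comp (Primrec.fst.comp Primrec.fst)).pair Primrec.snd))
  have h2 : CxP Γ fun _ (a : ((((ℕ × ℕ) × ℕ) × List ℕ) × ℕ) × ℕ) =>
      bitPoint a.2 ∈ codedClopen a.1.1.1.2 :=
    CxP.bitPoint_mem (Cx.of_primrec Primrec.snd) (Cx.of_primrec
      (Primrec.snd.comp (Primrec.fst.comp (Primrec.fst.comp Primrec.fst))))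
  have h3 : CxP Γ fun _ (a : ((((ℕ × ℕ) × ℕ) × List ℕ) × ℕ) × ℕ) =>
      bitPoint a.2 ∈ codedClopen a.1.2 :=
    CxP.bitPoint_mem (Cx.of_primrec Primrec.snd) (Cx.of_primrec (Primrec.snd.comp Primrec.fst))
  have h4 : CxP Γ fun _ (a : (((ℕ × ℕ) × ℕ) × List ℕ) × ℕ) =>
      a.1.1.1.2 * 2 ^ a.2 ≤ bitCount a.2 * 2 ^ a.1.1.1.1 :=
    CxP.of_primrec (Primrec.nat_le.comp
      (Primrec.nat_mul.comp
        (Primrec.snd.comp (Primrec.fst.comp (Primrec.fst.comp Primrec.fst)))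
        (primrec_two_pow.comp Primrec.snd))
      (Primrec.nat_mul.comp (primrec_bitCount.comp Primrec.snd)
        (primrec_two_pow.comp
          (Primrec.fst.comp (Primrec.fst.comp (Primrec.fst.comp Primrec.fst))))))
  exact ((h1.imp (h2.imp h3)).forall.imp h4).forall

theorem CxP.isNear (hd : Cx Γ d) :
    CxP Γ fun x (a : (ℕ × ℕ) × ℕ) => IsNear (d x) a.1.1 a.1.2 a.2 := by
  have h1 : CxP Γ fun x (a : (ℕ × ℕ) × ℕ) =>
      ∃ h : ℕ → ℕ, ∀ n, StageLE (d x) a.1.1 a.1.2 a.2 (initSeg h n) :=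
    (CxP.stageLE hd).suslin
  have h2 : CxP Γ fun _ (a : (ℕ × ℕ) × ℕ) =>
      bitCount a.2 * 2 ^ a.1.1 ≤ (a.1.2 + 2) * 2 ^ a.2 :=
    CxP.of_primrec (Primrec.nat_le.comp
      (Primrec.nat_mul.comp (primrec_bitCount.comp Primrec.snd)
        (primrec_two_pow.comp (Primrec.fst.comp Primrec.fst)))
      (Primrec.nat_mul.comp
        (Primrec.nat_add.comp (Primrec.snd.comp Primrec.fst) (Primrec.const 2))
        (primrec_two_pow.comp Primrec.snd)))
  have h3 : CxP Γ fun x (a : (ℕ × ℕ) × ℕ) =>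
      ∃ h : ℕ → ℕ, ∀ n, StageLE (d x) a.1.1 (a.1.2 + 1) univCode (initSeg h n) :=
    h1.comp (φ := fun _ (a : (ℕ × ℕ) × ℕ) => ((a.1.1, a.1.2 + 1), univCode)) (Cx.of_primrec
      (((Primrec.fst.comp Primrec.fst).pair
        (Primrec.succ.comp (Primrec.snd.comp Primrec.fst))).pair (Primrec.const _)))
  exact h1.and (h2.and h3.not)

theorem Cx.exists_run {φ : Γ.carrier → Unit → ℕ} (hφ : Cx Γ φ) :
    ∃ e, ∀ i, Run suslinFunctional (Γ.fn i) e (Γ.base i) (φ i ()) := by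
  obtain ⟨e, he⟩ := hφ
  exact ⟨_, fun i => (he i ()).comp ((Run.id _).pair (Run.const 0 _))⟩

end Decidability

/-! ### Subtrees by address, and the two recursive steps -/

section Addresses

/-- The position in a code of the argument `n` of the code of the subtree with address `u`: the
entry `0` of an address leads to the only subtree of a complement, and the entry `m + 1` to the
subtree for the sequence with number `m`. -/
def position (u : List ℕ) (n : ℕ) : ℕ :=
  u.foldl (fun n a => Nat.casesOn a (n + 1) fun m => Nat.pair m n + 1) n

/-- The code of the subtree with address `u`. -/
def codeAt (f : ℕ → ℕ) (u : List ℕ) : ℕ → ℕ := fun n => f (position u n)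

theorem primrec_position : Primrec₂ position := by
  have : Primrec₂ fun n a : ℕ => (Nat.casesOn a (n + 1) fun m => Nat.pair m n + 1 : ℕ) :=
    Primrec.nat_casesOn Primrec.snd (Primrec.succ.comp Primrec.fst)
      (Primrec.succ.comp (Primrec₂.natPair.comp Primrec.snd (Primrec.fst.comp Primrec.fst)))
  exact Primrec.list_foldl Primrec.fst Primrec.snd
    (this.comp (Primrec.fst.comp Primrec.snd) (Primrec.snd.comp Primrec.snd)).to₂

/-- The data of a recursive call: the code `f`, the index `r` for recursive calls, the
precision `k` and the address `u`. -/
structure Node where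
  /-- the code -/
  f : ℕ → ℕ
  /-- the index for recursive calls -/
  r : ℕ
  /-- the precision -/
  k : ℕ
  /-- the address -/
  u : List ℕ

/-- The number argument of a recursive call. -/
def Node.arg (x : Node) : ℕ := Nat.pair x.r (Nat.pair x.k (encode x.u))

/-- The context of a family of recursive calls. -/
def nodeContext {X : Type} (node : X → Node) : Context :=
  ⟨X, fun x => (node x).f, fun x => (node x).arg⟩

variable {X : Type} {node : X → Node} {α : Type} [Primcodable α]

theorem Cx.node_r : Cx (nodeContext node) fun x (_ : α) => (node x).r := by
  have := Cx.prim (Primrec.fst.comp Primrec.unpair) (Cx.base (Γ := nodeContext node) (α := α))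
  simpa [nodeContext, Node.arg] using this

theorem Cx.node_k : Cx (nodeContext node) fun x (_ : α) => (node x).k := by
  have := Cx.prim (Primrec.fst.comp (Primrec.unpair.comp (Primrec.snd.comp Primrec.unpair)))
    (Cx.base (Γ := nodeContext node) (α := α))
  simpa [nodeContext, Node.arg] using this

theorem Cx.node_u : Cx (nodeContext node) fun x (_ : α) => (node x).u := by
  have := Cx.prim (Primrec.option_getD.comp (Primrec.decode (α := List ℕ).comp
      (Primrec.snd.comp (Primrec.unpair.comp (Primrec.snd.comp Primrec.unpair))))
      (Primrec.const [])) (Cx.base (Γ := nodeContext node) (α := α))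
  simpa [nodeContext, Node.arg] using this

theorem Cx.codeAt (n : ℕ) :
    Cx (nodeContext node) fun x (_ : α) => codeAt (node x).f (node x).u n :=
  Cx.oracle (Γ := nodeContext node)
    (Cx.prim₂ primrec_position Cx.node_u (Cx.of_primrec (Primrec.const n)))

theorem exists_run_codeAt (n : ℕ) :
    ∃ e, ∀ x : Node, Run suslinFunctional x.f e x.arg (SuslinMeasure.codeAt x.f x.u n) :=
  (Cx.codeAt (node := id) n).exists_run

theorem exists_run_compl :
    ∃ e, ∀ (x : Node) (b : ℕ),
      Run suslinFunctional x.f x.r (Nat.pair x.k (encode (0 :: x.u))) b →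
      ∃ c, Run suslinFunctional x.f e x.arg c ∧ codedClopen c = (codedClopen b)ᶜ := by
  -- An environment bundles a node with the value of its recursive call and the evidence of
  -- convergence, so that the call is total in this context.
  let Y := {y : Node × ℕ //
    Run suslinFunctional y.1.f y.1.r (Nat.pair y.1.k (encode (0 :: y.1.u))) y.2}
  let Γ := nodeContext fun y : Y => y.1.1
  have hb : ∀ {α : Type} [Primcodable α], Cx Γ fun y (_ : α) => y.1.2 := fun {α} _ =>
    Cx.call Cx.node_r (Cx.prim₂ Primrec₂.natPair Cx.node_k
      (Cx.prim Primrec.encode (Cx.prim₂ Primrec.list_cons (Cx.of_primrec (Primrec.const 0))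
        Cx.node_u))) fun y _ => y.2
  have h1 : CxP Γ fun y (a : (Unit × ℕ) × ℕ) => bitPoint a.2 ∈ codedClopen a.1.2 :=
    CxP.bitPoint_mem (Cx.of_primrec Primrec.snd) (Cx.of_primrec (Primrec.snd.comp Primrec.fst))
  have h2 : CxP Γ fun y (a : (Unit × ℕ) × ℕ) => bitPoint a.2 ∈ codedClopen y.1.2 :=
    CxP.bitPoint_mem (Cx.of_primrec Primrec.snd) hb
  have h3 := ((h1.imp h2.not).and (h2.not.imp h1)).forall
  obtain ⟨φ, hφ, hφ'⟩ := h3.search fun y _ => by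
    obtain ⟨c, hc⟩ := (hasLevel_codedClopen y.1.2).compl.exists_codedClopen
    exact ⟨c, fun i => by simp [hc]⟩
  obtain ⟨e, he⟩ := hφ.exists_run
  refine ⟨e, fun x b hxb => ⟨_, he ⟨(x, b), hxb⟩, ?_⟩⟩
  have hlev := (hasLevel_codedClopen b).compl
  exact Set.Subset.antisymm
    ((hasLevel_codedClopen _).subset_of_bitPoint hlev fun i => (hφ' ⟨(x, b), hxb⟩ () i).1)
    (hlev.subset_of_bitPoint (hasLevel_codedClopen _) fun i => (hφ' ⟨(x, b), hxb⟩ () i).2)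

/-- The precision `k + 2 + encode s` of the calls makes their total error at most `2 ^ (-(k + 1))`;
nearness at `k + 3` costs `3 * 2 ^ (-(k + 3))`, which is below the other half. -/
theorem exists_run_suslin :
    ∃ e, ∀ (x : Node) (d : List ℕ → ℕ),
      (∀ s, Run suslinFunctional x.f x.r
        (Nat.pair (x.k + 2 + encode s) (encode ((encode s + 1) :: x.u))) (d s)) →
      ∃ c, Run suslinFunctional x.f e x.arg c ∧ ∃ i, IsNear d (x.k + 3) i c := by
  let Y := {y : Node × (List ℕ → ℕ) // ∀ s, Run suslinFunctional y.1.f y.1.r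
    (Nat.pair (y.1.k + 2 + encode s) (encode ((encode s + 1) :: y.1.u))) (y.2 s)}
  let Γ := nodeContext fun y : Y => y.1.1
  have hs : Cx Γ fun _ s => encode s := Cx.of_primrec (Primrec.encode (α := List ℕ))
  have hk : Cx Γ fun y (s : List ℕ) => y.1.1.k + 2 + encode s :=
    Cx.prim₂ Primrec.nat_add (Cx.prim₂ Primrec.nat_add Cx.node_k
      (Cx.of_primrec (Primrec.const 2))) hs
  have hu : Cx Γ fun y (s : List ℕ) => encode ((encode s + 1) :: y.1.1.u) :=
    Cx.prim Primrec.encode (Cx.prim₂ Primrec.list_cons (Cx.prim Primrec.succ hs) Cx.node_u)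
  have hd : Cx Γ fun y s => y.1.2 s :=
    Cx.call (ψ := fun (y : Γ.carrier) (s : List ℕ) =>
      Nat.pair (y.1.1.k + 2 + encode s) (encode ((encode s + 1) :: y.1.1.u)))
      Cx.node_r (Cx.prim₂ Primrec₂.natPair hk hu) fun y s => y.2 s
  have h1 : CxP Γ fun y (a : (Unit × ℕ) × ℕ) => IsNear y.1.2 (y.1.1.k + 3) a.2 a.1.2 :=
    (CxP.isNear hd).comp
      (φ := fun (y : Γ.carrier) (a : (Unit × ℕ) × ℕ) => ((y.1.1.k + 3, a.2), a.1.2))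
      (((Cx.prim₂ Primrec.nat_add Cx.node_k (Cx.of_primrec (Primrec.const 3))).pair
        (Cx.of_primrec Primrec.snd)).pair (Cx.of_primrec (Primrec.snd.comp Primrec.fst)))
  obtain ⟨φ, hφ, hφ'⟩ := h1.exists_nat.search fun y _ => by
    obtain ⟨i, c, hc⟩ := exists_isNear y.1.2 (y.1.1.k + 3)
    exact ⟨c, i, hc⟩
  obtain ⟨e, he⟩ := hφ.exists_run
  exact ⟨e, fun x d hxd => ⟨_, he ⟨(x, d), hxd⟩, hφ' ⟨(x, d), hxd⟩ ()⟩⟩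

end Addresses

/-! ### The recursion along the code -/

/-- A single index approximates in measure the sets that are coded, by clopen sets. -/
theorem exists_run_approx :
    ∃ r, ∀ (κ : CodeKind) (g : ℕ → ℕ) (P : Set Cantor), IsCode κ g P →
      ∀ (f : ℕ → ℕ) (u : List ℕ), codeAt f u = g → ∀ k, ∃ c,
        Run suslinFunctional f r (Nat.pair k (encode u)) c ∧
          cantorMeasure (P ∆ codedClopen c) ≤ 2⁻¹ ^ k := by
  obtain ⟨lab, hlab⟩ := exists_run_codeAt 0
  obtain ⟨clo, hclo⟩ := exists_run_codeAt 1
  obtain ⟨com, hcom⟩ := exists_run_compl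
  obtain ⟨sus, hsus⟩ := exists_run_suslin
  obtain ⟨m, hm⟩ := exists_run_branch suslinFunctional
    (I := fun v => if v = 0 then clo else if v = 1 then sus else com)
    (Primrec.ite (Primrec.eq.comp Primrec.id (Primrec.const 0)) (Primrec.const _)
      (Primrec.ite (Primrec.eq.comp Primrec.id (Primrec.const 1)) (Primrec.const _)
        (Primrec.const _))) lab
  obtain ⟨r, hr⟩ := exists_run_fixedPoint suslinFunctional m
  refine ⟨r, fun κ g P hP => ?_⟩
  -- Convergence of `r` is proved by induction on the code tree, for all addresses at which the
  -- given code is found inside `f`.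
  induction hP with
  | clopen g L h0 h1 =>
    rintro f u rfl k
    refine ⟨encode L, hr _ _ _ (hm _ _ _ _ (hlab ⟨f, r, k, u⟩) ?_), ?_⟩
    · have := hclo ⟨f, r, k, u⟩
      simp only [h0, h1] at this ⊢
      exact this
    · rw [codedClopen_encode, symmDiff_self]
      simp
  | suslin g P h0 _ ih =>
    rintro f u rfl k
    have key : ∀ s, ∃ c, Run suslinFunctional f r
        (Nat.pair (k + 2 + encode s) (encode ((encode s + 1) :: u))) c ∧
        cantorMeasure (P s ∆ codedClopen c) ≤ 2⁻¹ ^ (k + 2 + encode s) :=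
      -- Addresses list the deepest edge first, so lengthening one at the head passes to the subcode
      -- by definition.
      fun s => ih s f ((encode s + 1) :: u) rfl _
    choose d hd hd' using key
    obtain ⟨c, hc, i, hi⟩ := hsus ⟨f, r, k, u⟩ d hd
    refine ⟨c, hr _ _ _ (hm _ _ _ _ (hlab ⟨f, r, k, u⟩) ?_), ?_⟩
    · simp only [h0]
      exact hc
    · have h1 := measure_suslinOp_symmDiff_le (k := k + 1) hd'
      have h2 := hi.measure_symmDiff_le
      refine (measure_mono (symmDiff_triangle _ (suslinOp fun s => codedClopen (d s)) _)).trans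
        ((measure_union_le _ _).trans ((add_le_add h1 h2).trans ?_))
      have h3 : (3 : ℝ≥0∞) * 2⁻¹ ^ (k + 3) ≤ 2⁻¹ ^ (k + 1) := by
        calc (3 : ℝ≥0∞) * 2⁻¹ ^ (k + 3) ≤ (2 * 2) * 2⁻¹ ^ (k + 3) := by gcongr; norm_num
          _ = 2⁻¹ ^ (k + 1) * ((2 * 2⁻¹) * (2 * 2⁻¹)) := by ring
          _ = _ := by rw [ENNReal.mul_inv_cancel (by simp) (by simp)]; simp
      calc (2⁻¹ : ℝ≥0∞) ^ (k + 1) + 3 * 2⁻¹ ^ (k + 3) ≤ 2⁻¹ ^ (k + 1) + 2⁻¹ ^ (k + 1) := by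
            gcongr
        _ = 2⁻¹ ^ k * (2⁻¹ + 2⁻¹) := by ring
        _ = 2⁻¹ ^ k := by rw [ENNReal.inv_two_add_inv_two, mul_one]
  | compl g P h0 _ ih =>
    rintro f u rfl k
    obtain ⟨b, hb, hb'⟩ := ih f (0 :: u) rfl k
    obtain ⟨c, hc, hc'⟩ := hcom ⟨f, r, k, u⟩ b hb
    refine ⟨c, hr _ _ _ (hm _ _ _ _ (hlab ⟨f, r, k, u⟩) ?_), ?_⟩
    · simp only [h0]
      exact hc
    · rwa [hc', compl_symmDiff_compl]

/-! ### From approximations to the Dedekind cut -/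

/-- The inequality `q + 2 ^ (-k) < m` between the rational number `q` with number `n` and the
measure `m` of the clopen set with number `c`, without denominators. -/
def CutLT (n k c : ℕ) : Prop :=
  n.unpair.1.unpair.1 * 2 ^ k * 2 ^ c + (n.unpair.2 + 1) * 2 ^ c <
    bitCount c * (n.unpair.2 + 1) * 2 ^ k + n.unpair.1.unpair.2 * 2 ^ k * 2 ^ c

theorem cutLT_iff {n k c : ℕ} :
    CutLT n k c ↔ (ratEnum n : ℝ) + 2⁻¹ ^ k < cantorMeasure.real (codedClopen c) := by
  rw [cantorMeasure_real_codedClopen, CutLT, ← Nat.cast_lt (α := ℝ), ratEnum]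
  push_cast
  rw [inv_pow, ← one_div, div_add_div _ _ (by positivity) (by positivity),
    div_lt_div_iff₀ (by positivity) (by positivity)]
  constructor <;> intro h <;> linarith

theorem primrecPred_cutLT : PrimrecPred fun a : ℕ × ℕ × ℕ => CutLT a.1 a.2.1 a.2.2 := by
  have hk : Primrec fun a : ℕ × ℕ × ℕ => 2 ^ a.2.1 :=
    primrec_two_pow.comp (Primrec.fst.comp Primrec.snd)
  have hc : Primrec fun a : ℕ × ℕ × ℕ => 2 ^ a.2.2 :=
    primrec_two_pow.comp (Primrec.snd.comp Primrec.snd)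
  have hn : Primrec fun a : ℕ × ℕ × ℕ => a.1.unpair := Primrec.unpair.comp Primrec.fst
  have hn₁ : Primrec fun a : ℕ × ℕ × ℕ => a.1.unpair.1.unpair :=
    Primrec.unpair.comp (Primrec.fst.comp hn)
  have hn₂ : Primrec fun a : ℕ × ℕ × ℕ => a.1.unpair.2 + 1 :=
    Primrec.succ.comp (Primrec.snd.comp hn)
  have hb : Primrec fun a : ℕ × ℕ × ℕ => bitCount a.2.2 :=
    primrec_bitCount.comp (Primrec.snd.comp Primrec.snd)
  have mul := Primrec.nat_mul
  exact Primrec.nat_lt.comp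
    (Primrec.nat_add.comp (mul.comp (mul.comp (Primrec.fst.comp hn₁) hk) hc) (mul.comp hn₂ hc))
    (Primrec.nat_add.comp (mul.comp (mul.comp hb hn₂) hk)
      (mul.comp (mul.comp (Primrec.snd.comp hn₁) hk) hc))

/-- By `lt_measure_iff_of_approx` the cut is an existential number quantifier over an arithmetical
comparison with the `k`-th approximation, so one more use of `S` decides it. -/
theorem exists_run_cut (r : ℕ) :
    ∃ e, ∀ f d : ℕ → ℕ, (∀ k, Run suslinFunctional f r (Nat.pair k 0) (d k)) →
      ∀ P : Set Cantor, (∀ k, cantorMeasure (P ∆ codedClopen (d k)) ≤ 2⁻¹ ^ k) →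
        ∀ n, Run suslinFunctional f e n (dedekindCut (cantorMeasure.real P) n) := by
  let Γ : Context := ⟨{y : (ℕ → ℕ) × (ℕ → ℕ) //
    ∀ k, Run suslinFunctional y.1 r (Nat.pair k 0) (y.2 k)}, fun y => y.1.1, fun _ => 0⟩
  have hd : Cx Γ fun y (k : ℕ) => y.1.2 k :=
    Cx.call (Cx.of_primrec (Primrec.const r)) (Cx.prim₂ Primrec₂.natPair
      (Cx.of_primrec Primrec.id) (Cx.of_primrec (Primrec.const 0))) fun y k => y.2 k
  have h : CxP Γ fun y (a : ℕ × ℕ) => CutLT a.1 a.2 (y.1.2 a.2) :=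
    (CxP.of_primrec primrecPred_cutLT).comp
      (φ := fun (y : Γ.carrier) (a : ℕ × ℕ) => (a.1, a.2, y.1.2 a.2))
      ((Cx.of_primrec Primrec.fst).pair ((Cx.of_primrec Primrec.snd).pair
        (hd.comp (Cx.of_primrec Primrec.snd))))
  obtain ⟨e, he⟩ := h.exists_nat
  refine ⟨compIx e (pairIx suslinFunctional (Nat.pair 2 0) (Nat.pair 3 0)),
    fun f d hfd P hP n => ?_⟩
  have := (he ⟨(f, d), hfd⟩ n).comp ((Run.const 0 n).pair (Run.id n))
  convert this using 1
  have hiff : (ratEnum n : ℝ) < cantorMeasure.real P ↔ ∃ k, CutLT n k (d k) := by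
    rw [lt_measure_iff_of_approx hP]
    exact exists_congr fun k => cutLT_iff.symm
  by_cases hk : ∃ k, CutLT n k (d k)
  · simp [dedekindCut, hiff, hk]
  · simp [dedekindCut, hiff, hk]

end SuslinMeasure

theorem mainTheorem5 :
    ∃ e : ℕ, ∀ (k : SuslinMeasure.CodeKind) (f : ℕ → ℕ) (P : Set SuslinMeasure.Cantor),
      SuslinMeasure.IsCode k f P →
        MeasureTheory.NullMeasurableSet P SuslinMeasure.cantorMeasure ∧
        ∀ n : ℕ, SuslinMeasure.KleeneComp SuslinMeasure.suslinFunctional e [n] [f]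
          (SuslinMeasure.dedekindCut (SuslinMeasure.cantorMeasure.real P) n) := by
  obtain ⟨r, hr⟩ := SuslinMeasure.exists_run_approx
  obtain ⟨e, he⟩ := SuslinMeasure.exists_run_cut r
  refine ⟨e, fun k f P hP => ?_⟩
  -- The empty address names `f` itself, and its code is the `0` expected by `exists_run_cut`.
  choose d hd hd' using hr k f P hP f [] rfl
  exact ⟨SuslinMeasure.nullMeasurableSet_of_approx
    (fun k => SuslinMeasure.measurableSet_codedClopen (d k)) hd',
    fun n => he f d hd P hd' n []⟩
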